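/- Let $0<q<1$, $[x]=\frac{q^x-q^{-x}}{q-q^{-1}}$, and let $\mathcal H=\bigoplus_{j\in\frac12\mathbb Z_{\ge 0}}V_j$ have basis $|j\,m\rangle$ ($m=-j,-j+1,\dots,j$), with the action of $U_q(sl(2))$ $$J_3|j\,m\rangle=m|j\,m\rangle,\qquad J_\pm|j\,m\rangle=F^\pm(j,m)\,|j,m\pm1\rangle,\qquad F^\pm(j,m)=\sqrt{[j\mp m][j\pm m+1]},$$ coproduct $\Delta(J_\pm)=J_\pm\otimes q^{J_3}+q^{-J_3}\otimes J_\pm$ and Casimir $C=J_+J_-+[J_3][J_3-1]$. Vectors $|j\,m\rangle$ with inadmissible labels are read as $0$. An (irreducible) $q$-tensor of rank $j$ is a family of operators $T^j_m$ on $\mathcal H$ ($-j\le m\le j$; $T^j_m=0$ for other $m$) with $$J_3(T^j_m):=[J_3,T^j_m]=m\,T^j_m,\qquad J_\pm(T^j_m):=J_\pm T^j_m q^{J_3}-q^{J_3\mp1}T^j_mJ_\pm=F^\pm(j,m)\,T^j_{m\pm1}.$$ On the crystal basis put $\tilde J_\pm|j\,m\rangle=|j,m\pm1\rangle$ ($=0$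 at the ends). A *crystal tensor* of rank $j$ is a family of operators $\tau^j_m$ ($\tau^j_m=0$ unless $m\in\{-j,\dots,j\}$) on $\mathcal H$ with $J_3(\tau^j_m):=[J_3,\tau^j_m]=m\,\tau^j_m$ which transforms under $\tilde J_\pm$ like the crystal basis vectors $|j\,m\rangle$, $\tilde J_\pm(\tau^j_m)=\tau^j_{m\pm1}$, in the sense that $\tilde J_\pm$ acts on $\tau^j_m|j_1m_1\rangle$ by the tensor product rule of crystal bases for $|j\,m\rangle\otimes|j_1m_1\rangle$: * $\tilde J_-(\tau^j_m|j_1m_1\rangle)=\tau^j_{m-1}|j_1m_1\rangle$ if for some $n\ge1$ one has $\tilde J_-^n|j\,m\rangle\ne0$ and $\tilde J_+^n|j_1m_1\rangle=0$; otherwise it equals $\tau^j_m\tilde J_-|j_1m_1\rangle$; * $\tilde J_+(\tau^j_m|j_1m_1\rangle)=\tau^j_m\tilde J_+|j_1m_1\rangle$ if for some $n\ge1$ one has $\tilde J_+^n|j_1m_1\rangle\ne0$ and $\tilde J_-^n|j\,m\rangle=0$; otherwise it equals $\tau^j_{m+1}|j_1m_1\rangle$. **Theorem.** Let $j\in\frac12\mathbb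 Z_{\ge0}$. (1) For every crystal tensor $\tau^j$ there are reduced matrix elements $\langle J\|\tau^j\|j_1\rangle\in\mathbb C$ such that for all admissible $m,j_1,m_1$ $$\tau^j_m|j_1m_1\rangle=(-1)^{2j}\sum_{\alpha=0}^{2j}(-1)^\alpha\,\langle j_1+j-\alpha\|\tau^j\|j_1\rangle\,S_\alpha\;|j_1+j-\alpha,\,m_1+m\rangle,\qquad(\ast)$$ $$S_\alpha=\delta_{m_1,j_1-\alpha}\,\theta(\alpha\le j+m)+\delta_{-m,j-\alpha}\,\theta(\alpha\le j_1-m_1)-\delta_{m_1,j_1-\alpha}\,\delta_{-m,j-\alpha},$$ where $\theta(P)$ is $1$ if $P$ holds and $0$ otherwise; thus $S_\alpha=1$ if $\alpha=\min(j_1-m_1,\,j+m)$ and $S_\alpha=0$ otherwise. Moreover all allowed ($S_\alpha=1$) transition amplitudes from $V_{j_1}$ to the same final irreducible representation $V_{j_1+j-\alpha}$ are equal: $\langle j_1+j-\alpha,m_1+m|\tau^j_m|j_1m_1\rangle$ does not depend on $m_1$, $m$. (2) For $q$ near $0^+$ let $T^j(q)$ be a $q$-tensor of rank $j$ and let $\Gamma(q)$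 be central (an operator on $\mathcal H$ commuting with $J_3,J_\pm$). Put $\widehat T^j_m=\Gamma T^j_m\Gamma$ and suppose that, as $q\to0^+$, all matrix elements of $\widehat T^j_m(q)$ converge to those of operators $\tau^j_m$. Then $\tau^j$ is a crystal tensor. Moreover $C$, acting on operators, satisfies $C(\widehat T^j_m)=[j][j+1]\,\widehat T^j_m$ for all small $q>0$, and for $-j\le m\le j$, with $\tilde J_\pm(\widehat T^j_m)=([j][j+1])^{-1/2}J_\pm(\widehat T^j_m)$ (read as $0$ if $j=0$), one has $\tilde J_\pm(\widehat T^j_m)\to\tau^j_{m\pm1}$ as $q\to0^+$, for all matrix elements. Finally, there are numbers $\langle J\|\widehat T^j\|j_1\rangle$, depending on $q$, with $$\langle JM|\widehat T^j_m|j_1m_1\rangle=(-1)^{2j}\,\frac{\langle J\|\widehat T^j\|j_1\rangle}{\sqrt{[2J+1]}}\,\langle j_1m_1\,j\,m|JM\rangle_q$$ for all small $q>0$, where $\langle j_1m_1\,j\,m|JM\rangle_q$ are the $q$-Clebsch–Gordan coefficients of $V_{j_1}\otimes V_j$ for $\Delta$ (normalised by $\langle j_1j_1\,j\,(J-j_1)|JJ\rangle_q>0$,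 and zero if $V_J$ does not occur in $V_{j_1}\otimes V_j$). For every $J\in\{|j_1-j|,|j_1-j|+1,\dots,j_1+j\}$ the limit $$\langle J\|\tau^j\|j_1\rangle=\lim_{q\to0^+}\frac{\langle J\|\widehat T^j\|j_1\rangle}{\sqrt{[2J+1]}}$$ exists, and $(\ast)$ holds with these reduced matrix elements. -/

import Mathlib

open Filter Topology
open scoped TensorProduct

noncomputable section

namespace CrystalTensor

/-- `j, m` label a basis vector `|j m⟩`: `j` is a nonnegative half-integer and
`m ∈ {-j, -j+1, …, j}`. -/
def IsWeight (j m : ℚ) : Prop :=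
  (∃ a : ℕ, j - m = a) ∧ (∃ b : ℕ, j + m = b)

abbrev Label : Type := {p : ℚ × ℚ // IsWeight p.1 p.2}

/-- The state space: the direct sum over all half-integers `j ≥ 0` of the irreducible
representations of spin `j`, with basis `|j m⟩`. -/
abbrev H : Type := Label →₀ ℂ

abbrev Op : Type := Module.End ℂ H

open Classical in
/-- The vector `|j m⟩`, which is read as zero when `(j, m)` is not an admissible label. -/
def ket (j m : ℚ) : H :=
  if h : IsWeight j m then Finsupp.single ⟨(j, m), h⟩ 1 else 0

open Classical in
/-- The functional `⟨j m|`. -/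
def bra (j m : ℚ) : H →ₗ[ℂ] ℂ :=
  if h : IsWeight j m then Finsupp.lapply ⟨(j, m), h⟩ else 0

/-- The operator with `|j m⟩ ↦ v j m`. -/
def opOfBasis (v : ℚ → ℚ → H) : Op :=
  Finsupp.linearCombination ℂ (fun p : Label => v p.1.1 p.1.2)

/-! ### The quantum algebra acting on the state space

The sign `s` is `1` for `J₊` and `-1` for `J₋`. -/

/-- The `q`-number `[x] = (q^x - q^{-x}) / (q - q^{-1})`. -/
def qNum (q x : ℝ) : ℝ := (q ^ x - q ^ (-x)) / (q - q⁻¹)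

/-- `F^±(j, m) = √([j ∓ m] [j ± m + 1])`. -/
def F (q : ℝ) (s j m : ℚ) : ℝ :=
  Real.sqrt (qNum q ((j - s * m : ℚ) : ℝ) * qNum q ((j + s * m + 1 : ℚ) : ℝ))

def J3 : Op := opOfBasis (fun j m => (m : ℂ) • ket j m)

/-- `J_±` for the deformation parameter `q`. -/
def J (q : ℝ) (s : ℚ) : Op :=
  opOfBasis (fun j m => ((F q s j m : ℝ) : ℂ) • ket j (m + s))

/-- `q^{t J₃}`. -/
def qJ3 (q : ℝ) (t : ℚ) : Op :=
  opOfBasis (fun j m => ((q ^ ((t * m : ℚ) : ℝ) : ℝ) : ℂ) • ket j m)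

/-- `Γ` belongs to the centre: it commutes with all the generators.  Such operators are the
functions of the Casimir operator. -/
def IsCentral (q : ℝ) (Γ : Op) : Prop :=
  Commute Γ J3 ∧ Commute Γ (J q 1) ∧ Commute Γ (J q (-1))

/-- The coproduct `Δ(J_±) = J_± ⊗ q^{J₃} + q^{-J₃} ⊗ J_±`. -/
def coprodJ (q : ℝ) (s : ℚ) : Module.End ℂ (H ⊗[ℂ] H) :=
  TensorProduct.map (J q s) (qJ3 q 1) + TensorProduct.map (qJ3 q (-1)) (J q s)

/-! ### `q`-Clebsch-Gordan coefficients -/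

/-- Spin `J` occurs in the tensor product of the spins `j₁` and `j`:
`J ∈ {|j₁ - j|, |j₁ - j| + 1, …, j₁ + j}`. -/
def IsTriangle (j₁ j J : ℚ) : Prop :=
  (∃ a : ℕ, j₁ + j - J = a) ∧ (∃ b : ℕ, j₁ + J - j = b) ∧ (∃ c : ℕ, j + J - j₁ = c)

/-- Unnormalised coefficients of `|j₁, j₁ - k⟩ ⊗ |j, J - j₁ + k⟩` in the highest weight vector
of spin `J`: the recursion says that `Δ(J₊)` kills that vector, and the positive sign at `k = 0`
is the usual phase convention. -/
def hwCoeff (q : ℝ) (j₁ j J : ℚ) : ℕ → ℝ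
  | 0 => 1
  | k + 1 => -(hwCoeff q j₁ j J k * q ^ ((-J - 1 : ℚ) : ℝ) * F q 1 j (J - j₁ + k)
      / F q 1 j₁ (j₁ - k - 1))

/-- The normalised highest weight vector `|J J⟩` of spin `J` in `j₁ ⊗ j`. -/
def hwVec (q : ℝ) (j₁ j J : ℚ) : H ⊗[ℂ] H :=
  (((Real.sqrt (∑ k ∈ Finset.range (⌊j₁ + j - J⌋₊ + 1), hwCoeff q j₁ j J k ^ 2))⁻¹ : ℝ) : ℂ) •
    ∑ k ∈ Finset.range (⌊j₁ + j - J⌋₊ + 1),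
      ((hwCoeff q j₁ j J k : ℝ) : ℂ) • (ket j₁ (j₁ - k) ⊗ₜ[ℂ] ket j (J - j₁ + k))

/-- The vector `|J, J - k⟩` in `j₁ ⊗ j`, obtained from `|J J⟩` by
`Δ(J₋) |J M⟩ = F⁻(J, M) |J, M - 1⟩`. -/
def coupled (q : ℝ) (j₁ j J : ℚ) : ℕ → H ⊗[ℂ] H
  | 0 => hwVec q j₁ j J
  | k + 1 => (((F q (-1) J (J - k))⁻¹ : ℝ) : ℂ) • coprodJ q (-1) (coupled q j₁ j J k)

open Classical in
/-- The `q`-Clebsch-Gordan coefficient `⟨j₁ m₁ j m | J M⟩`, zero unless spin `J` occurs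
in `j₁ ⊗ j`. -/
def qCG (q : ℝ) (j₁ m₁ j m J M : ℚ) : ℂ :=
  if IsTriangle j₁ j J ∧ IsWeight J M then
    LinearMap.mul' ℂ ℂ (TensorProduct.map (bra j₁ m₁) (bra j m) (coupled q j₁ j J ⌊J - M⌋₊))
  else 0

/-! ### Tensor operators for generic `q` -/

/-- `J₃(X) = [J₃, X]`. -/
def adJ3 (X : Op) : Op := J3 * X - X * J3

/-- `J_±(X) = J_± X q^{J₃} - q^{J₃ ∓ 1} X J_±`, the action on operators induced by the
coproduct through the requirement that `v ⊗ X ↦ X v` intertwines. -/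
def adJ (q : ℝ) (s : ℚ) (X : Op) : Op :=
  J q s * X * qJ3 q 1 - ((q ^ ((-s : ℚ) : ℝ) : ℝ) : ℂ) • (qJ3 q 1 * X * J q s)

/-- `[J₃ + c](X)`, where `q^{J₃}(X) = q^{J₃} X q^{-J₃}`. -/
def adQNum (q : ℝ) (c : ℚ) (X : Op) : Op :=
  (((q - q⁻¹)⁻¹ : ℝ) : ℂ) •
    (((q ^ ((c : ℚ) : ℝ) : ℝ) : ℂ) • (qJ3 q 1 * X * qJ3 q (-1))
      - ((q ^ ((-c : ℚ) : ℝ) : ℝ) : ℂ) • (qJ3 q (-1) * X * qJ3 q 1))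

/-- The Casimir `C = J₊ J₋ + [J₃][J₃ - 1]` acting on operators. -/
def adCasimir (q : ℝ) (X : Op) : Op :=
  adJ q 1 (adJ q (-1) X) + adQNum q 0 (adQNum q (-1) X)

/-- The action of `J̃_± = C^{-1/2} J_±` on operators of rank `j`, on which `C` acts as
`[j][j+1]`.  (For `j = 0` it is zero.) -/
def adJTilde (q : ℝ) (j s : ℚ) (X : Op) : Op :=
  (((qNum q (j : ℝ) * qNum q ((j + 1 : ℚ) : ℝ)) ^ (-(1 / 2) : ℝ) : ℝ) : ℂ) • adJ q s X

/-- Irreducible `q`-tensor operator of rank `j`, with components `T m`, `-j ≤ m ≤ j`. -/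
structure IsQTensor (q : ℝ) (j : ℚ) (T : ℚ → Op) : Prop where
  eq_zero : ∀ m, ¬ IsWeight j m → T m = 0
  weight : ∀ m, IsWeight j m → adJ3 (T m) = (m : ℂ) • T m
  shift : ∀ s : ℚ, s = 1 ∨ s = -1 → ∀ m, IsWeight j m →
    adJ q s (T m) = ((F q s j m : ℝ) : ℂ) • T (m + s)

/-- `X q → Y` as `q → 0⁺`, for all matrix elements. -/
def OpTendsto (X : ℝ → Op) (Y : Op) : Prop :=
  ∀ J M j m : ℚ, Tendsto (fun q => bra J M (X q (ket j m))) (𝓝[>] (0 : ℝ))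
    (𝓝 (bra J M (Y (ket j m))))

/-! ### The crystal limit -/

/-- `J̃_±` on the crystal basis: `J̃_± |j m⟩ = |j, m ± 1⟩`, zero at the ends. -/
def JTilde (s : ℚ) : Op := opOfBasis (fun j m => ket j (m + s))

open Classical in
/-- Crystal tensor of rank `j`: `J₃(τ_m) = m τ_m` and, with `J̃_±(τ_m) = τ_{m ± 1}`
(where `τ_m = 0` if `|m| > j`), the products `τ_m |j₁ m₁⟩` transform under `J̃_±` as the elements
`|j m⟩ ⊗ |j₁ m₁⟩` of the tensor product of crystal bases. -/
structure IsCrystalTensor (j : ℚ) (τ : ℚ → Op) : Prop where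
  eq_zero : ∀ m, ¬ IsWeight j m → τ m = 0
  weight : ∀ m, IsWeight j m → adJ3 (τ m) = (m : ℂ) • τ m
  lower : ∀ m j₁ m₁, IsWeight j m → IsWeight j₁ m₁ →
    JTilde (-1) (τ m (ket j₁ m₁)) =
      if ∃ n : ℕ, 1 ≤ n ∧ (JTilde (-1) ^ n) (ket j m) ≠ 0 ∧ (JTilde 1 ^ n) (ket j₁ m₁) = 0
      then τ (m - 1) (ket j₁ m₁)
      else τ m (JTilde (-1) (ket j₁ m₁))
  raise : ∀ m j₁ m₁, IsWeight j m → IsWeight j₁ m₁ →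
    JTilde 1 (τ m (ket j₁ m₁)) =
      if ∃ n : ℕ, 1 ≤ n ∧ (JTilde 1 ^ n) (ket j₁ m₁) ≠ 0 ∧ (JTilde (-1) ^ n) (ket j m) = 0
      then τ m (JTilde 1 (ket j₁ m₁))
      else τ (m + 1) (ket j₁ m₁)

/-- Kronecker delta. -/
def δ (x y : ℚ) : ℂ := if x = y then 1 else 0

/-- Truth value as a number: `1` if `x ≤ y`, else `0`. -/
def θ (x y : ℚ) : ℂ := if x ≤ y then 1 else 0

/-- The selection factor; it is `1` if `α = min (j₁ - m₁) (j + m)` and `0` otherwise. -/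
def sel (j₁ m₁ j m α : ℚ) : ℂ :=
  δ m₁ (j₁ - α) * θ α (j + m) + δ (-m) (j - α) * θ α (j₁ - m₁)
    - δ m₁ (j₁ - α) * δ (-m) (j - α)

/-- The `(q → 0)`-Wigner-Eckart formula for a tensor of rank `j = n / 2`, with reduced matrix
elements `r J j₁ = ⟨J ‖ τ ‖ j₁⟩`. -/
def CrystalWignerEckart (n : ℕ) (τ : ℚ → Op) (r : ℚ → ℚ → ℂ) : Prop :=
  let j : ℚ := n / 2
  ∀ m j₁ m₁, IsWeight j m → IsWeight j₁ m₁ →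
    τ m (ket j₁ m₁) = (-1 : ℂ) ^ n • ∑ α ∈ Finset.range (n + 1),
      ((-1 : ℂ) ^ α * r (j₁ + j - α) j₁ * sel j₁ m₁ j m α) • ket (j₁ + j - α) (m₁ + m)

/-- All the allowed transition amplitudes from the irreducible representation `j₁` to one
irreducible representation `j₁ + j - α` coincide. -/
def EqualAmplitudes (j : ℚ) (τ : ℚ → Op) : Prop :=
  ∀ (j₁ m₁ m m₁' m' : ℚ) (α : ℕ), IsWeight j₁ m₁ → IsWeight j m → IsWeight j₁ m₁' →
    IsWeight j m' → sel j₁ m₁ j m α ≠ 0 → sel j₁ m₁' j m' α ≠ 0 →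
    bra (j₁ + j - α) (m₁ + m) (τ m (ket j₁ m₁)) =
      bra (j₁ + j - α) (m₁' + m') (τ m' (ket j₁ m₁'))

/-- The `q`-Wigner-Eckart formula for a tensor of rank `j = n / 2`, with reduced matrix elements
`R J j₁ = ⟨J ‖ T ‖ j₁⟩`. -/
def QWignerEckart (q : ℝ) (n : ℕ) (T : ℚ → Op) (R : ℚ → ℚ → ℂ) : Prop :=
  let j : ℚ := n / 2
  ∀ J M m j₁ m₁, IsWeight J M → IsWeight j m → IsWeight j₁ m₁ →
    bra J M (T m (ket j₁ m₁)) =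
      (-1 : ℂ) ^ n * (R J j₁ / ((Real.sqrt (qNum q ((2 * J + 1 : ℚ) : ℝ)) : ℝ) : ℂ))
        * qCG q j₁ m₁ j m J M

end CrystalTensor

end

open CrystalTensor

noncomputable section

namespace CrystalTensor

/-! ### Labels, bras and kets -/

/-! Both halves of the theorem reduce to one combinatorial picture. Fix the spin `j₁` and put `p =
2j₁`, `n = 2j`, `a = j₁ - m₁`, `b = j + m`, so that `τ_m |j₁ m₁⟩` sits at a point of the rectangle
`0 ≤ a ≤ p`, `0 ≤ b ≤ n`. The rectangle is a disjoint union of hooks `min a b = α`, and a hook is a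
crystal of spin `j₁ + j - α`. `HasChainForm` says that on each hook `τ` is one scalar times the
crystal basis of that spin. This yields the Wigner-Eckart formula and the equality of amplitudes at
once (`HasChainForm.crystalWignerEckart`, `HasChainForm.equalAmplitudes`).

A crystal tensor has this form because the tip `(α, n)` of a hook is annihilated by `J̃₊`, so it is
a multiple of a highest weight vector, and `J̃₋` then walks along the whole hook
(`IsCrystalTensor.hasChainForm`). Conversely, the crystal rule never leaves a hook, so the form
implies the rule (`HasChainForm.isCrystalTensor`).

For the limit, the covariance of `T` is a three-term recursion between matrix elements
(`IsQTensor.recursion`). Since `F^±(j, m)` behaves like `q^(1/2 - j)` for every `m` inside the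
spectrum, each term has a definite power of `q`, and only the terms of least exponent survive after
rescaling (`limit_recursion`). The surviving relations force zero off the hook and a constant on it
(`LimitRelations.eq_zero`, `LimitRelations.eq_top`).

At fixed `q`, the matrix elements into `⟨J J|` obey the recursion defining the highest weight vector
of spin `J` in `j₁ ⊗ j`, and lowering transports this to all weights, which is the `q`-Wigner-Eckart
theorem (`IsQTensor.wignerEckart`). As `q → 0⁺` the last coefficient of the highest weight vector
dominates, with sign `(-1)^α`; this identifies the limit of the reduced matrix elements
(`tendsto_hwNorm_div`, `tendsto_reducedElement`). -/

lemma IsWeight.nonneg {j m : ℚ} (h : IsWeight j m) : 0 ≤ j := by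
  obtain ⟨⟨a, ha⟩, b, hb⟩ := h
  have : (0 : ℚ) ≤ a + b := by positivity
  linarith

lemma IsWeight.le {j m : ℚ} (h : IsWeight j m) : m ≤ j := by
  obtain ⟨⟨a, ha⟩, b, hb⟩ := h
  have : (0 : ℚ) ≤ a := by positivity
  linarith

lemma IsWeight.neg_le {j m : ℚ} (h : IsWeight j m) : -j ≤ m := by
  obtain ⟨⟨a, ha⟩, b, hb⟩ := h
  have : (0 : ℚ) ≤ b := by positivity
  linarith

/-- Weights of `V_{j₁}` are counted down from the top and, in `isWeight_half_iff'`, those of rank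
`j` up from the bottom: the selection rule then reads `α = min a b`. Integer indices leave the
inequalities to `omega`. -/
lemma isWeight_half_iff {p : ℕ} {a : ℤ} :
    IsWeight ((p : ℚ) / 2) ((p : ℚ) / 2 - a) ↔ 0 ≤ a ∧ a ≤ p := by
  constructor
  · rintro ⟨⟨x, hx⟩, y, hy⟩
    have h1 : (a : ℚ) = (x : ℤ) := by push_cast; linarith
    have h2 : ((p - a : ℤ) : ℚ) = (y : ℤ) := by push_cast; linarith
    norm_cast at h1 h2
    omega
  · rintro ⟨h1, h2⟩
    lift a to ℕ using h1
    have h2' : a ≤ p := by exact_mod_cast h2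
    refine ⟨⟨a, by push_cast; ring⟩, p - a, ?_⟩
    push_cast [Nat.cast_sub h2']
    ring

lemma isWeight_half_iff' {n : ℕ} {b : ℤ} :
    IsWeight ((n : ℚ) / 2) (b - (n : ℚ) / 2) ↔ 0 ≤ b ∧ b ≤ n := by
  have : (b : ℚ) - (n : ℚ) / 2 = (n : ℚ) / 2 - ((n - b : ℤ) : ℚ) := by push_cast; ring
  rw [this, isWeight_half_iff]
  omega

lemma IsWeight.exists_half {j m : ℚ} (h : IsWeight j m) :
    ∃ p a : ℕ, a ≤ p ∧ j = (p : ℚ) / 2 ∧ m = (p : ℚ) / 2 - a := by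
  obtain ⟨⟨a, ha⟩, b, hb⟩ := h
  refine ⟨a + b, a, by omega, ?_, ?_⟩ <;> push_cast <;> linarith

lemma IsWeight.exists_nat_add {n : ℕ} {m : ℚ} (h : IsWeight ((n : ℚ) / 2) m) :
    ∃ b : ℕ, b ≤ n ∧ m = b - (n : ℚ) / 2 := by
  obtain ⟨⟨a, ha⟩, b, hb⟩ := h
  refine ⟨b, ?_, by linarith⟩
  have : ((a + b : ℕ) : ℚ) = (n : ℕ) := by push_cast; linarith
  have : a + b = n := by exact_mod_cast this
  omega

/-- If `m + s` is a weight but `m` is not, then `m` is just beyond the end of the spectrum. -/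
lemma IsWeight.of_add_sign {j m s : ℚ} (hs : s = 1 ∨ s = -1) (h : IsWeight j (m + s))
    (hm : ¬ IsWeight j m) : j + s * m + 1 = 0 := by
  obtain ⟨⟨a, ha⟩, b, hb⟩ := h
  rcases hs with rfl | rfl
  · rcases b with _ | b
    · push_cast at hb; linarith
    · exact absurd ⟨⟨a + 1, by push_cast; linarith⟩, b, by push_cast at hb; linarith⟩ hm
  · rcases a with _ | a
    · push_cast at ha; linarith
    · exact absurd ⟨⟨a, by push_cast at ha; linarith⟩, b + 1, by push_cast; linarith⟩ hm

/-- If `m` is a weight but `m + s` is not, then `m` is at the end of the spectrum. -/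
lemma IsWeight.of_not_add_sign {j m s : ℚ} (hs : s = 1 ∨ s = -1) (h : IsWeight j m)
    (hm : ¬ IsWeight j (m + s)) : j - s * m = 0 := by
  have := IsWeight.of_add_sign (j := j) (m := m + s) (s := -s)
    (by rcases hs with rfl | rfl <;> simp) (by simpa using h) hm
  rcases hs with rfl | rfl <;> linarith

lemma ket_of_not {j m : ℚ} (h : ¬ IsWeight j m) : ket j m = 0 := by simp [ket, h]

lemma bra_of_not {j m : ℚ} (h : ¬ IsWeight j m) : bra j m = 0 := by simp [bra, h]

lemma ket_of {j m : ℚ} (h : IsWeight j m) : ket j m = Finsupp.single ⟨(j, m), h⟩ 1 := by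
  simp [ket, h]

lemma bra_apply_of {j m : ℚ} (h : IsWeight j m) (x : H) : bra j m x = x ⟨(j, m), h⟩ := by
  simp [bra, h]

lemma bra_ket_self {j m : ℚ} (h : IsWeight j m) : bra j m (ket j m) = 1 := by
  simp [bra_apply_of h, ket_of h]

lemma bra_ket_of_ne {j m j' m' : ℚ} (h : ¬ (j = j' ∧ m = m')) : bra j m (ket j' m') = 0 := by
  by_cases h1 : IsWeight j m
  · by_cases h2 : IsWeight j' m'
    · rw [bra_apply_of h1, ket_of h2, Finsupp.single_apply, if_neg]
      intro h3
      simp only [Subtype.mk.injEq, Prod.mk.injEq] at h3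
      exact h ⟨h3.1.symm, h3.2.symm⟩
    · simp [ket_of_not h2]
  · simp [bra_of_not h1]

lemma ext_bra {x y : H} (h : ∀ J M, IsWeight J M → bra J M x = bra J M y) : x = y := by
  ext ⟨⟨J, M⟩, hp⟩
  have := h J M hp
  rwa [bra_apply_of hp, bra_apply_of hp] at this

lemma linearMap_ext_ket {V : Type*} [AddCommMonoid V] [Module ℂ V] {f g : H →ₗ[ℂ] V}
    (h : ∀ j m, IsWeight j m → f (ket j m) = g (ket j m)) : f = g := by
  refine Finsupp.lhom_ext' fun ⟨⟨j, m⟩, hp⟩ => LinearMap.ext_ring ?_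
  have := h j m hp
  rw [ket_of hp] at this
  simpa using this

lemma opOfBasis_ket (v : ℚ → ℚ → H) {j m : ℚ} (h : IsWeight j m) :
    opOfBasis v (ket j m) = v j m := by
  simp [opOfBasis, ket_of h]

lemma J3_ket (j m : ℚ) : J3 (ket j m) = (m : ℂ) • ket j m := by
  by_cases h : IsWeight j m
  · exact opOfBasis_ket _ h
  · simp [ket_of_not h]

lemma qJ3_ket (q : ℝ) (t j m : ℚ) :
    qJ3 q t (ket j m) = ((q ^ ((t * m : ℚ) : ℝ) : ℝ) : ℂ) • ket j m := by
  by_cases h : IsWeight j m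
  · exact opOfBasis_ket _ h
  · simp [ket_of_not h]

lemma JTilde_ket (s : ℚ) {j m : ℚ} (h : IsWeight j m) : JTilde s (ket j m) = ket j (m + s) :=
  opOfBasis_ket _ h

/-! ### Matrix elements of the generators -/

lemma qNum_zero (q : ℝ) : qNum q 0 = 0 := by simp [qNum]

lemma F_eq_zero_of_sub {q : ℝ} {s j m : ℚ} (h : j - s * m = 0) : F q s j m = 0 := by
  simp [F, h, qNum_zero]

lemma F_eq_zero_of_add {q : ℝ} {s j m : ℚ} (h : j + s * m + 1 = 0) : F q s j m = 0 := by
  simp [F, h, qNum_zero]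

lemma F_neg {q : ℝ} {s : ℚ} (hs : s = 1 ∨ s = -1) (j m : ℚ) :
    F q (-s) j (m + s) = F q s j m := by
  unfold F
  rw [mul_comm (qNum _ _)]
  rcases hs with rfl | rfl <;> congr 4 <;> ring

/-- No admissibility is needed: if only `m + s` is admissible, then `m` lies one step beyond the end
and the factor `F` vanishes. -/
lemma J_ket (q : ℝ) {s : ℚ} (hs : s = 1 ∨ s = -1) (j m : ℚ) :
    J q s (ket j m) = ((F q s j m : ℝ) : ℂ) • ket j (m + s) := by
  by_cases h : IsWeight j m
  · exact opOfBasis_ket _ h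
  · by_cases h' : IsWeight j (m + s)
    · simp [ket_of_not h, F_eq_zero_of_add (h'.of_add_sign hs h)]
    · simp [ket_of_not h, ket_of_not h']

lemma bra_comp_J3 (J' M : ℚ) : bra J' M ∘ₗ J3 = (M : ℂ) • bra J' M := by
  refine linearMap_ext_ket fun j m _ => ?_
  by_cases h : J' = j ∧ M = m
  · simp [J3_ket, h.1, h.2]
  · simp [J3_ket, bra_ket_of_ne h]

lemma bra_comp_qJ3 (q : ℝ) (t J' M : ℚ) :
    bra J' M ∘ₗ qJ3 q t = ((q ^ ((t * M : ℚ) : ℝ) : ℝ) : ℂ) • bra J' M := by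
  refine linearMap_ext_ket fun j m _ => ?_
  by_cases h : J' = j ∧ M = m
  · simp [qJ3_ket, h.1, h.2]
  · simp [qJ3_ket, bra_ket_of_ne h]

lemma bra_comp_J (q : ℝ) {s : ℚ} (hs : s = 1 ∨ s = -1) (J' M : ℚ) :
    bra J' (M + s) ∘ₗ J q s = ((F q s J' M : ℝ) : ℂ) • bra J' M := by
  refine linearMap_ext_ket fun j m hm => ?_
  by_cases h : J' = j ∧ M = m
  · obtain ⟨rfl, rfl⟩ := h
    by_cases h' : IsWeight J' (M + s)
    · simp [J_ket q hs, bra_ket_self hm, bra_ket_self h']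
    · simp [J_ket q hs, ket_of_not h', F_eq_zero_of_sub (hm.of_not_add_sign hs h')]
  · have h' : ¬ (J' = j ∧ M + s = m + s) := by simpa using h
    simp [J_ket q hs, bra_ket_of_ne h, bra_ket_of_ne h']

lemma bra_J3 (J' M : ℚ) (x : H) : bra J' M (J3 x) = (M : ℂ) * bra J' M x :=
  LinearMap.congr_fun (bra_comp_J3 J' M) x

lemma bra_qJ3 (q : ℝ) (t J' M : ℚ) (x : H) :
    bra J' M (qJ3 q t x) = ((q ^ ((t * M : ℚ) : ℝ) : ℝ) : ℂ) * bra J' M x :=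
  LinearMap.congr_fun (bra_comp_qJ3 q t J' M) x

lemma bra_J (q : ℝ) {s : ℚ} (hs : s = 1 ∨ s = -1) (J' M : ℚ) (x : H) :
    bra J' (M + s) (J q s x) = ((F q s J' M : ℝ) : ℂ) * bra J' M x :=
  LinearMap.congr_fun (bra_comp_J q hs J' M) x

/-- An operator commuting with `J₃` preserves weights. -/
lemma bra_ket_eq_zero_of_commute_J3 {Γ : Op} (h : Commute Γ J3) {J' M j m : ℚ} (hM : M ≠ m) :
    bra J' M (Γ (ket j m)) = 0 := by
  have h1 := congrArg (bra J' M) (LinearMap.congr_fun h (ket j m))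
  simp only [Module.End.mul_apply, J3_ket, bra_J3, map_smul, smul_eq_mul] at h1
  have h2 : ((m : ℂ) - M) * bra J' M (Γ (ket j m)) = 0 := by linear_combination h1
  refine (mul_eq_zero.1 h2).resolve_left (sub_ne_zero.2 ?_)
  exact_mod_cast hM.symm

/-- `IsCentral` mentions only `J₃` and `J_±`, while `adJ` also contains `q^{J₃}`, which is a scalar
on each weight space. -/
lemma commute_qJ3_of_commute_J3 {Γ : Op} (h : Commute Γ J3) (q : ℝ) (t : ℚ) :
    Commute Γ (qJ3 q t) := by
  refine linearMap_ext_ket fun j m _ => ext_bra fun J' M _ => ?_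
  simp only [Module.End.mul_apply, qJ3_ket, bra_qJ3, map_smul, smul_eq_mul]
  by_cases hM : M = m
  · rw [hM]
  · simp [bra_ket_eq_zero_of_commute_J3 h hM]

/-! ### `q`-tensors -/

lemma Op.mul_sub (A B C : Op) : A * (B - C) = A * B - A * C :=
  LinearMap.ext fun _ => map_sub A _ _

lemma Op.sub_mul (A B C : Op) : (A - B) * C = A * C - B * C := rfl

lemma Op.smul_sub (c : ℂ) (A B : Op) : c • (A - B) = c • A - c • B :=
  LinearMap.ext fun x => _root_.smul_sub c (A x) (B x)

lemma Op.sub_self (A : Op) : A - A = 0 :=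
  LinearMap.ext fun _ => _root_.sub_self _

/-- Both `Γ` factors commute past everything in `adJ3` and `adJ`. Hence the regularisation can be
forgotten: all later results are about one family of `q`-tensors. -/
lemma IsQTensor.central_mul_mul {q : ℝ} {j : ℚ} {T : ℚ → Op} {Γ : Op} (hT : IsQTensor q j T)
    (hΓ : IsCentral q Γ) : IsQTensor q j (fun m => Γ * T m * Γ) := by
  obtain ⟨h3, hp, hm⟩ := hΓ
  refine ⟨fun m h => by simp [hT.eq_zero m h], fun m h => ?_, fun s hs m h => ?_⟩
  · have := hT.weight m h
    have h2 : adJ3 (Γ * T m * Γ) = Γ * adJ3 (T m) * Γ := by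
      simp only [adJ3, Op.mul_sub, Op.sub_mul]
      congr 1
      · simp only [← mul_assoc, h3.eq]
      · simp only [mul_assoc, h3.eq]
    rw [h2, this]
    simp
  · have := hT.shift s hs m h
    have hJ : Commute Γ (J q s) := by rcases hs with rfl | rfl <;> assumption
    have hq := commute_qJ3_of_commute_J3 h3 q 1
    have h2 : adJ q s (Γ * T m * Γ) = Γ * adJ q s (T m) * Γ := by
      simp only [adJ, Op.mul_sub, Op.sub_mul, mul_smul_comm, smul_mul_assoc]
      congr 1
      · simp only [← mul_assoc, ← hJ.eq]
        simp only [mul_assoc, hq.eq]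
      · congr 1
        simp only [← mul_assoc, ← hq.eq]
        simp only [mul_assoc, hJ.eq]
    rw [h2, this]
    simp

/-- The weight selection rule. -/
lemma bra_ket_eq_zero_of_adJ3 {X : Op} {m : ℚ} (h : adJ3 X = (m : ℂ) • X) {J' M j₁ m₁ : ℚ}
    (hM : M ≠ m₁ + m) : bra J' M (X (ket j₁ m₁)) = 0 := by
  have h1 := congrArg (bra J' M) (LinearMap.congr_fun h (ket j₁ m₁))
  simp only [adJ3, LinearMap.sub_apply, Module.End.mul_apply, J3_ket, bra_J3, map_smul, map_sub,
    smul_eq_mul, LinearMap.smul_apply] at h1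
  have h2 : ((M : ℂ) - (m₁ + m)) * bra J' M (X (ket j₁ m₁)) = 0 := by linear_combination h1
  refine (mul_eq_zero.1 h2).resolve_left (sub_ne_zero.2 ?_)
  exact_mod_cast hM

lemma IsQTensor.bra_ket_eq_zero {q : ℝ} {j : ℚ} {T : ℚ → Op} (hT : IsQTensor q j T)
    {J' M m j₁ m₁ : ℚ} (hM : M ≠ m₁ + m) : bra J' M (T m (ket j₁ m₁)) = 0 := by
  by_cases h : IsWeight j m
  · exact bra_ket_eq_zero_of_adJ3 (hT.weight m h) hM
  · simp [hT.eq_zero m h]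

/-- The recursion relation satisfied by the matrix elements of a `q`-tensor. -/
lemma IsQTensor.recursion {q : ℝ} (hq : 0 < q) {j : ℚ} {T : ℚ → Op} (hT : IsQTensor q j T)
    {s : ℚ} (hs : s = 1 ∨ s = -1) {J' m j₁ m₁ : ℚ} (hm : IsWeight j m) :
    ((F q s J' (m₁ + m) : ℝ) : ℂ) * bra J' (m₁ + m) (T m (ket j₁ m₁)) =
      ((F q s j m * q ^ (-m₁ : ℝ) : ℝ) : ℂ) * bra J' (m₁ + m + s) (T (m + s) (ket j₁ m₁)) +
      ((F q s j₁ m₁ * q ^ (m : ℝ) : ℝ) : ℂ) * bra J' (m₁ + m + s) (T m (ket j₁ (m₁ + s))) := by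
  have h1 := congrArg (bra J' (m₁ + m + s)) (LinearMap.congr_fun (hT.shift s hs m hm) (ket j₁ m₁))
  simp only [adJ, LinearMap.sub_apply, Module.End.mul_apply, qJ3_ket, bra_J _ hs, bra_qJ3,
    J_ket _ hs, map_smul, map_sub, smul_eq_mul, LinearMap.smul_apply] at h1
  have e1 : q ^ ((1 * m₁ : ℚ) : ℝ) * q ^ (-m₁ : ℝ) = 1 := by
    rw [← Real.rpow_add hq]; simp
  have e2 : q ^ ((-s : ℚ) : ℝ) * q ^ ((1 * (m₁ + m + s) : ℚ) : ℝ) * q ^ (-m₁ : ℝ)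
      = q ^ (m : ℝ) := by
    rw [← Real.rpow_add hq, ← Real.rpow_add hq]; congr 1; push_cast; ring
  have e1' := congrArg (fun x : ℝ => (x : ℂ)) e1
  have e2' := congrArg (fun x : ℝ => (x : ℂ)) e2
  simp only [Complex.ofReal_mul, Complex.ofReal_one] at e1' e2' ⊢
  -- Multiplying by `q^{-m₁}` cancels the `q^{J₃}` acting on the ket in the first term of `adJ` and
  -- turns the prefactor of the second into `q^m`.
  linear_combination ((q ^ (-m₁ : ℝ) : ℝ) : ℂ) * h1
    - ((F q s J' (m₁ + m) : ℝ) : ℂ) * bra J' (m₁ + m) (T m (ket j₁ m₁)) * e1'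
    + ((F q s j₁ m₁ : ℝ) : ℂ) * bra J' (m₁ + m + s) (T m (ket j₁ (m₁ + s))) * e2'

lemma adQNum_of_weight {q : ℝ} (hq : 0 < q) (c : ℚ) {X : Op} {m : ℚ}
    (h : adJ3 X = (m : ℂ) • X) :
    adQNum q c X = ((qNum q ((m + c : ℚ) : ℝ) : ℝ) : ℂ) • X := by
  refine linearMap_ext_ket fun j₁ m₁ _ => ext_bra fun J' M _ => ?_
  simp only [adQNum, LinearMap.sub_apply, Module.End.mul_apply, qJ3_ket, bra_qJ3, map_smul,
    map_sub, smul_eq_mul, LinearMap.smul_apply]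
  by_cases hM : M = m₁ + m
  · subst hM
    have e1 : q ^ (c : ℝ) * q ^ ((1 * (m₁ + m) : ℚ) : ℝ) * q ^ ((-1 * m₁ : ℚ) : ℝ)
        = q ^ ((m + c : ℚ) : ℝ) := by
      rw [← Real.rpow_add hq, ← Real.rpow_add hq]; congr 1; push_cast; ring
    have e2 : q ^ ((-c : ℚ) : ℝ) * q ^ ((-1 * (m₁ + m) : ℚ) : ℝ) * q ^ ((1 * m₁ : ℚ) : ℝ)
        = q ^ (-((m + c : ℚ) : ℝ)) := by
      rw [← Real.rpow_add hq, ← Real.rpow_add hq]; congr 1; push_cast; ring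
    rw [qNum, ← e1, ← e2]
    simp only [Complex.ofReal_mul, Complex.ofReal_sub, Complex.ofReal_div, Complex.ofReal_inv]
    ring
  · simp [bra_ket_eq_zero_of_adJ3 h hM]

lemma qNum_nonneg {q x : ℝ} (hq : 0 < q) (hq1 : q < 1) (hx : 0 ≤ x) : 0 ≤ qNum q x := by
  have h1 : q ^ x ≤ q ^ (-x) := Real.rpow_le_rpow_of_exponent_ge hq hq1.le (by linarith)
  have h2 : 1 < q⁻¹ := (one_lt_inv₀ hq).2 hq1
  exact div_nonneg_of_nonpos (by linarith) (by linarith)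

lemma qNum_pos {q x : ℝ} (hq : 0 < q) (hq1 : q < 1) (hx : 0 < x) : 0 < qNum q x := by
  have h1 : q ^ x < q ^ (-x) := Real.rpow_lt_rpow_of_exponent_gt hq hq1 (by linarith)
  have h2 : 1 < q⁻¹ := (one_lt_inv₀ hq).2 hq1
  exact div_pos_of_neg_of_neg (by linarith) (by linarith)

lemma qNum_neg (q x : ℝ) : qNum q (-x) = - qNum q x := by
  simp only [qNum, neg_neg]; ring

lemma F_pos {q : ℝ} (hq : 0 < q) (hq1 : q < 1) {s j m : ℚ} (h1 : 0 < j - s * m)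
    (h2 : 0 < j + s * m + 1) : 0 < F q s j m :=
  Real.sqrt_pos.2 (mul_pos (qNum_pos hq hq1 (by exact_mod_cast h1))
    (qNum_pos hq hq1 (by exact_mod_cast h2)))

/-- `[x][y]` depends only on `x + y` and `x - y` up to sign. The sum `2j + 1` is the same on both
sides, the two terms in `2m - 1` cancel, and the remaining differences are `±1`. -/
lemma qNum_mul_add_qNum_mul {q : ℝ} (hq : 0 < q) (j m : ℝ) :
    qNum q (j + m) * qNum q (j - m + 1) + qNum q m * qNum q (m - 1) =
      qNum q j * qNum q (j + 1) := by
  have key : ∀ x y : ℝ, qNum q x * qNum q y =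
      (q ^ (x + y) + q ^ (-(x + y)) - q ^ (x - y) - q ^ (-(x - y))) / (q - q⁻¹) ^ 2 := by
    intro x y
    have e1 : q ^ (x + y) = q ^ x * q ^ y := Real.rpow_add hq _ _
    have e2 : q ^ (-(x + y)) = q ^ (-x) * q ^ (-y) := by rw [← Real.rpow_add hq]; ring_nf
    have e3 : q ^ (x - y) = q ^ x * q ^ (-y) := by rw [← Real.rpow_add hq]; ring_nf
    have e4 : q ^ (-(x - y)) = q ^ (-x) * q ^ y := by rw [← Real.rpow_add hq]; ring_nf
    rw [e1, e2, e3, e4, qNum, qNum, div_mul_div_comm, ← sq]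
    congr 1
    ring
  simp only [key]
  rw [← add_div]
  ring_nf

lemma IsQTensor.adCasimir_eq {q : ℝ} (hq : 0 < q) (hq1 : q < 1) {j : ℚ} {T : ℚ → Op}
    (hT : IsQTensor q j T) (m : ℚ) :
    adCasimir q (T m) = ((qNum q (j : ℝ) * qNum q ((j + 1 : ℚ) : ℝ) : ℝ) : ℂ) • T m := by
  by_cases hm : IsWeight j m
  swap
  · simp [hT.eq_zero m hm, adCasimir, adJ, adQNum, Op.sub_self]
  have hw : adJ3 (((qNum q ((m + -1 : ℚ) : ℝ) : ℝ) : ℂ) • T m) =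
      (m : ℂ) • (((qNum q ((m + -1 : ℚ) : ℝ) : ℝ) : ℂ) • T m) := by
    rw [smul_comm, ← hT.weight m hm]
    simp only [adJ3, mul_smul_comm, smul_mul_assoc, Op.smul_sub]
  have h1 : adJ q 1 (adJ q (-1) (T m)) = ((F q (-1) j m ^ 2 : ℝ) : ℂ) • T m := by
    rw [hT.shift (-1) (.inr rfl) m hm]
    have hlin : ∀ (c : ℂ) X, adJ q 1 (c • X) = c • adJ q 1 X := by
      intro c X
      simp only [adJ, mul_smul_comm, smul_mul_assoc, Op.smul_sub]
      congr 1
      exact smul_comm _ _ _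
    rw [hlin]
    -- At the lowest weight `T (m - 1)` is zero, and so is `F^-(j, m)`; otherwise `F^+(j, m - 1) =
    -- F^-(j, m)` gives the square.
    by_cases hm' : IsWeight j (m + -1)
    · rw [hT.shift 1 (.inl rfl) _ hm', smul_smul]
      have := F_neg (q := q) (s := -1) (.inr rfl) j m
      rw [neg_neg] at this
      rw [this, neg_add_cancel_right, ← Complex.ofReal_mul, sq]
    · rw [F_eq_zero_of_sub (hm.of_not_add_sign (.inr rfl) hm')]
      simp
  rw [adCasimir, h1, adQNum_of_weight hq (-1) (hT.weight m hm), adQNum_of_weight hq 0 hw,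
    smul_smul, ← add_smul]
  congr 1
  rw [← Complex.ofReal_mul, ← Complex.ofReal_add]
  congr 1
  rw [F, Real.sq_sqrt, Rat.cast_add j 1, Rat.cast_one,
    ← qNum_mul_add_qNum_mul hq (j : ℝ) (m : ℝ)]
  · push_cast
    ring_nf
  · refine mul_nonneg (qNum_nonneg hq hq1 ?_) (qNum_nonneg hq hq1 ?_)
    · have := hm.neg_le; exact_mod_cast (by linarith : (0 : ℚ) ≤ j - -1 * m)
    · have := hm.le; exact_mod_cast (by linarith : (0 : ℚ) ≤ j + -1 * m + 1)

/-! ### The `q`-Wigner-Eckart theorem -/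

/-- The coefficient of `|j₁ m₁⟩ ⊗ |j m⟩` in `|J, J - k⟩`. -/
def cgCoeff (q : ℝ) (j₁ j J' : ℚ) (k : ℕ) (m₁ m : ℚ) : ℂ :=
  LinearMap.mul' ℂ ℂ (TensorProduct.map (bra j₁ m₁) (bra j m) (coupled q j₁ j J' k))

lemma cgCoeff_of_not_left {q : ℝ} {j₁ j J' : ℚ} {k : ℕ} {m₁ m : ℚ} (h : ¬ IsWeight j₁ m₁) :
    cgCoeff q j₁ j J' k m₁ m = 0 := by
  simp [cgCoeff, bra_of_not h]

lemma cgCoeff_of_not_right {q : ℝ} {j₁ j J' : ℚ} {k : ℕ} {m₁ m : ℚ} (h : ¬ IsWeight j m) :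
    cgCoeff q j₁ j J' k m₁ m = 0 := by
  simp [cgCoeff, bra_of_not h]

/-- The transpose of `Δ(J₋)` on products of bras. Its coefficients are those of
`IsQTensor.recursion` with `s = 1`, which is why coupled vectors and matrix elements share one
lowering recursion. -/
lemma map_bra_coprodJ (q : ℝ) (j₁ j m₁ m : ℚ) (v : H ⊗[ℂ] H) :
    TensorProduct.map (bra j₁ m₁) (bra j m) (coprodJ q (-1) v) =
      ((F q 1 j m * q ^ (-m₁ : ℝ) : ℝ) : ℂ) • TensorProduct.map (bra j₁ m₁) (bra j (m + 1)) v +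
      ((F q 1 j₁ m₁ * q ^ (m : ℝ) : ℝ) : ℂ) •
        TensorProduct.map (bra j₁ (m₁ + 1)) (bra j m) v := by
  have hF : ∀ j m : ℚ, bra j m ∘ₗ J q (-1) = ((F q 1 j m : ℝ) : ℂ) • bra j (m + 1) := by
    intro j m
    have := bra_comp_J q (s := -1) (.inr rfl) j (m + 1)
    rwa [add_neg_cancel_right, F_neg (.inl rfl)] at this
  have h1 := LinearMap.congr_fun
    (TensorProduct.map_comp (bra j₁ m₁) (bra j m) (J q (-1)) (qJ3 q 1)) v
  have h2 := LinearMap.congr_fun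
    (TensorProduct.map_comp (bra j₁ m₁) (bra j m) (qJ3 q (-1)) (J q (-1))) v
  rw [LinearMap.comp_apply, hF, bra_comp_qJ3, TensorProduct.map_smul_left,
    TensorProduct.map_smul_right, smul_smul] at h1 h2
  rw [coprodJ, LinearMap.add_apply, map_add, ← h1, ← h2, add_comm]
  simp only [LinearMap.smul_apply]
  congr 2
  · rw [← Complex.ofReal_mul, mul_comm]; simp
  · rw [← Complex.ofReal_mul]; simp

lemma cgCoeff_succ (q : ℝ) (j₁ j J' : ℚ) (k : ℕ) (m₁ m : ℚ) :
    cgCoeff q j₁ j J' (k + 1) m₁ m = (((F q (-1) J' (J' - k))⁻¹ : ℝ) : ℂ) *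
      (((F q 1 j m * q ^ (-m₁ : ℝ) : ℝ) : ℂ) * cgCoeff q j₁ j J' k m₁ (m + 1) +
        ((F q 1 j₁ m₁ * q ^ (m : ℝ) : ℝ) : ℂ) * cgCoeff q j₁ j J' k (m₁ + 1) m) := by
  simp only [cgCoeff, coupled, map_smul, map_add, map_bra_coprodJ, smul_eq_mul]

/-- The norm of the unnormalised highest weight vector. -/
def hwNorm (q : ℝ) (j₁ j J' : ℚ) : ℝ :=
  Real.sqrt (∑ k ∈ Finset.range (⌊j₁ + j - J'⌋₊ + 1), hwCoeff q j₁ j J' k ^ 2)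

lemma hwNorm_pos (q : ℝ) (j₁ j J' : ℚ) : 0 < hwNorm q j₁ j J' := by
  refine Real.sqrt_pos.2 (Finset.sum_pos' (fun _ _ => sq_nonneg _) ⟨0, by simp, ?_⟩)
  simp [hwCoeff]

lemma cgCoeff_zero (q : ℝ) (j₁ j J' m₁ m : ℚ) :
    cgCoeff q j₁ j J' 0 m₁ m = (((hwNorm q j₁ j J')⁻¹ : ℝ) : ℂ) *
      ∑ k ∈ Finset.range (⌊j₁ + j - J'⌋₊ + 1), ((hwCoeff q j₁ j J' k : ℝ) : ℂ) *
        (bra j₁ m₁ (ket j₁ (j₁ - k)) * bra j m (ket j (J' - j₁ + k))) := by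
  simp only [cgCoeff, coupled, hwVec, hwNorm, map_smul, map_sum, TensorProduct.map_tmul,
    LinearMap.mul'_apply, smul_eq_mul]

lemma cgCoeff_zero_of_ne {q : ℝ} {j₁ j J' m₁ m : ℚ} (h : J' ≠ m₁ + m) :
    cgCoeff q j₁ j J' 0 m₁ m = 0 := by
  rw [cgCoeff_zero, Finset.sum_eq_zero, mul_zero]
  intro k _
  by_cases h1 : m₁ = j₁ - k
  · rw [bra_ket_of_ne (j := j) (m := m), mul_zero, mul_zero]
    rintro ⟨-, h2⟩
    exact h (by linarith)
  · rw [bra_ket_of_ne, zero_mul, mul_zero]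
    exact fun h2 => h1 h2.2

lemma cgCoeff_zero_of_le {q : ℝ} {j₁ j J' : ℚ} {i : ℕ} (hi : i ≤ ⌊j₁ + j - J'⌋₊)
    (h1 : IsWeight j₁ (j₁ - i)) (h2 : IsWeight j (J' - j₁ + i)) :
    cgCoeff q j₁ j J' 0 (j₁ - i) (J' - j₁ + i) =
      (((hwNorm q j₁ j J')⁻¹ * hwCoeff q j₁ j J' i : ℝ) : ℂ) := by
  rw [cgCoeff_zero, Finset.sum_eq_single i]
  · simp [bra_ket_self h1, bra_ket_self h2]
  · intro k _ hk
    rw [bra_ket_of_ne (j := j₁), zero_mul, mul_zero]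
    rintro ⟨-, h⟩
    exact hk (by exact_mod_cast (by linarith : (k : ℚ) = i))
  · intro h
    exact absurd (Finset.mem_range.2 (by omega)) h

/-- The chain of highest weight components in the matrix elements of a `q`-tensor. -/
lemma IsQTensor.highest_recursion {q : ℝ} (hq : 0 < q) {j : ℚ} {T : ℚ → Op}
    (hT : IsQTensor q j T) {J' j₁ : ℚ} {i : ℕ} (hm : IsWeight j (J' - j₁ + (i + 1))) :
    ((F q 1 j (J' - j₁ + i) : ℝ) : ℂ) *
        bra J' J' (T (J' - j₁ + i) (ket j₁ (j₁ - i))) +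
      ((F q 1 j₁ (j₁ - i - 1) * q ^ ((J' + 1 : ℚ) : ℝ) : ℝ) : ℂ) *
        bra J' J' (T (J' - j₁ + (i + 1)) (ket j₁ (j₁ - i - 1))) = 0 := by
  have h := hT.recursion hq (s := -1) (.inr rfl) (J' := J') (j₁ := j₁) (m₁ := j₁ - i) hm
  have e1 : j₁ - i + (J' - j₁ + (i + 1)) = J' + 1 := by ring
  have e2 : J' - j₁ + (i + 1) + -1 = J' - j₁ + i := by ring
  have e3 : F q (-1) j (J' - j₁ + (i + 1)) = F q 1 j (J' - j₁ + i) := by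
    rw [← F_neg (.inl rfl), add_assoc]
  have e4 : F q (-1) j₁ (j₁ - i) = F q 1 j₁ (j₁ - i - 1) := by
    rw [← F_neg (.inl rfl), sub_add_cancel]
  -- The bra `⟨J' J'|` annihilates the image of `J₋`: the coefficient `F^-(J', J' + 1)` vanishes,
  -- and a two-term relation remains.
  rw [e1, e2, e3, e4, add_neg_cancel_right, ← sub_eq_add_neg,
    F_eq_zero_of_add (s := -1) (m := J' + 1) (by ring)] at h
  have e5 : q ^ ((J' + 1 : ℚ) : ℝ) * q ^ (-((j₁ - i : ℚ) : ℝ))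
      = q ^ ((J' - j₁ + (i + 1) : ℚ) : ℝ) := by
    rw [← Real.rpow_add hq]; congr 1; push_cast; ring
  rw [← e5] at h
  have hne : ((q ^ (-((j₁ - i : ℚ) : ℝ)) : ℝ) : ℂ) ≠ 0 := by
    exact_mod_cast (Real.rpow_pos_of_pos hq _).ne'
  refine (mul_eq_zero.1 ?_).resolve_left hne
  simp only [Complex.ofReal_mul, Complex.ofReal_zero] at h ⊢
  linear_combination -h

/-- Families of numbers satisfying the lowering recursion of the coupled vectors are determined
by their highest weight components. -/
lemma eq_zero_of_lowering {q : ℝ} (hq : 0 < q) (hq1 : q < 1) {J' : ℚ} {K : ℕ}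
    (hK : 2 * J' = K) {A B : ℚ → ℚ → ℂ} {D : ℕ → ℚ → ℚ → ℂ}
    (h0 : ∀ m₁ m, D 0 m₁ m = 0)
    (hD : ∀ k m₁ m, k + 1 ≤ K → ((F q (-1) J' (J' - k) : ℝ) : ℂ) * D (k + 1) m₁ m =
      A m₁ m * D k m₁ (m + 1) + B m₁ m * D k (m₁ + 1) m) {k : ℕ} (hk : k ≤ K) (m₁ m : ℚ) :
    D k m₁ m = 0 := by
  induction k generalizing m₁ m with
  | zero => exact h0 m₁ m
  | succ k ih =>
    have h := hD k m₁ m hk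
    rw [ih (by omega), ih (by omega), mul_zero, mul_zero, add_zero] at h
    refine (mul_eq_zero.1 h).resolve_left ?_
    have hk' : ((k + 1 : ℕ) : ℚ) ≤ K := by exact_mod_cast hk
    push_cast at hk'
    have hk0 : (0 : ℚ) ≤ k := by positivity
    have hF := (F_pos hq hq1 (s := -1) (j := J') (m := J' - k) (by linarith) (by linarith)).ne'
    exact_mod_cast hF

/-- `⟨J, J - k| T_m |j₁ m₁⟩`, satisfying the lowering recursion. -/
lemma IsQTensor.lowering {q : ℝ} (hq : 0 < q) {j : ℚ} {T : ℚ → Op} (hT : IsQTensor q j T)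
    (J' j₁ : ℚ) (k : ℕ) (m₁ m : ℚ) :
    ((F q (-1) J' (J' - k) : ℝ) : ℂ) * bra J' (J' - (k + 1 : ℕ)) (T m (ket j₁ m₁)) =
      ((F q 1 j m * q ^ (-m₁ : ℝ) : ℝ) : ℂ) * bra J' (J' - k) (T (m + 1) (ket j₁ m₁)) +
      ((F q 1 j₁ m₁ * q ^ (m : ℝ) : ℝ) : ℂ) * bra J' (J' - k) (T m (ket j₁ (m₁ + 1))) := by
  by_cases hM : J' - (k + 1 : ℕ) = m₁ + m
  · by_cases hm : IsWeight j m
    · have h := hT.recursion hq (s := 1) (.inl rfl) (J' := J') (j₁ := j₁) (m₁ := m₁) hm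
      have e : m₁ + m + 1 = J' - k := by rw [← hM]; push_cast; ring
      rw [← F_neg (.inl rfl), e, ← hM] at h
      exact h
    · rw [hT.eq_zero m hm]
      by_cases hm' : IsWeight j (m + 1)
      · simp [F_eq_zero_of_add (hm'.of_add_sign (.inl rfl) hm)]
      · simp [hT.eq_zero _ hm']
  · have hM' : J' - k ≠ m₁ + (m + 1) := fun h => hM (by push_cast; linarith)
    have hM'' : J' - k ≠ (m₁ + 1) + m := fun h => hM (by push_cast; linarith)
    rw [hT.bra_ket_eq_zero hM, hT.bra_ket_eq_zero hM', hT.bra_ket_eq_zero hM'']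
    simp

lemma bra_T_eq_zero_of_not_weight {q : ℝ} {j : ℚ} {T : ℚ → Op} (hT : IsQTensor q j T)
    {J' M m j₁ m₁ : ℚ} (h : ¬ (IsWeight j m ∧ IsWeight j₁ m₁)) :
    bra J' M (T m (ket j₁ m₁)) = 0 := by
  by_cases hm : IsWeight j m
  · rw [ket_of_not fun h' => h ⟨hm, h'⟩, map_zero, map_zero]
  · simp [hT.eq_zero m hm]

lemma IsTriangle.bounds {j₁ j J' : ℚ} (h : IsTriangle j₁ j J') :
    J' ≤ j₁ + j ∧ j ≤ j₁ + J' ∧ j₁ ≤ j + J' := by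
  obtain ⟨⟨a, ha⟩, ⟨b, hb⟩, c, hc⟩ := h
  have h1 : (0 : ℚ) ≤ a := by positivity
  have h2 : (0 : ℚ) ≤ b := by positivity
  have h3 : (0 : ℚ) ≤ c := by positivity
  exact ⟨by linarith, by linarith, by linarith⟩

/-- Along the chain `m₁ + m = J'` the matrix elements obey the two-term recursion by which `hwCoeff`
is defined, so they are fixed by their value at `i = 0`. -/
lemma IsQTensor.highest_eq {q : ℝ} (hq : 0 < q) (hq1 : q < 1) {j : ℚ} {T : ℚ → Op}
    (hT : IsQTensor q j T) {J' j₁ : ℚ} (h : IsTriangle j₁ j J') {i : ℕ}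
    (hi : i ≤ ⌊j₁ + j - J'⌋₊) :
    bra J' J' (T (J' - j₁ + i) (ket j₁ (j₁ - i))) =
      ((hwCoeff q j₁ j J' i : ℝ) : ℂ) * bra J' J' (T (J' - j₁) (ket j₁ j₁)) := by
  have hb := h.bounds
  obtain ⟨⟨a, ha⟩, ⟨b, hb'⟩, c, hc⟩ := h
  rw [ha, Nat.floor_natCast] at hi
  induction i with
  | zero => simp [hwCoeff]
  | succ i ih =>
    have hi' : ((i + 1 : ℕ) : ℚ) ≤ a := by exact_mod_cast hi
    push_cast at hi'
    have hi0 : (0 : ℚ) ≤ i := by positivity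
    have hm : IsWeight j (J' - j₁ + (i + 1)) := by
      refine ⟨⟨a - (i + 1), ?_⟩, c + (i + 1), ?_⟩
      · push_cast [Nat.cast_sub hi]; linarith
      · push_cast; linarith
    have hrec := hT.highest_recursion hq (J' := J') hm
    rw [ih (by omega)] at hrec
    have hF : 0 < F q 1 j₁ (j₁ - i - 1) := F_pos hq hq1 (by linarith) (by linarith)
    have hQ : 0 < q ^ ((J' + 1 : ℚ) : ℝ) := Real.rpow_pos_of_pos hq _
    have hne : ((F q 1 j₁ (j₁ - i - 1) * q ^ ((J' + 1 : ℚ) : ℝ) : ℝ) : ℂ) ≠ 0 := by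
      exact_mod_cast (mul_pos hF hQ).ne'
    have e1 : j₁ - ((i + 1 : ℕ) : ℚ) = j₁ - i - 1 := by push_cast; ring
    have e2 : q ^ ((-J' - 1 : ℚ) : ℝ) = (q ^ ((J' + 1 : ℚ) : ℝ))⁻¹ := by
      rw [← Real.rpow_neg hq.le]; congr 1; push_cast; ring
    rw [e1, Nat.cast_succ]
    apply mul_left_cancel₀ hne
    have e3 : F q 1 j₁ (j₁ - i - 1) * q ^ ((J' + 1 : ℚ) : ℝ) * hwCoeff q j₁ j J' (i + 1) =
        -(F q 1 j (J' - j₁ + i) * hwCoeff q j₁ j J' i) := by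
      rw [hwCoeff, e2]
      field_simp
    rw [← mul_assoc, ← Complex.ofReal_mul, e3]
    simp only [Complex.ofReal_neg, Complex.ofReal_mul] at hrec ⊢
    linear_combination hrec

/-- The reduced matrix element of a `q`-tensor, up to the conventional factors. -/
def reducedElement (q : ℝ) (j : ℚ) (T : ℚ → Op) (J' j₁ : ℚ) : ℂ :=
  ((hwNorm q j₁ j J' : ℝ) : ℂ) * bra J' J' (T (J' - j₁) (ket j₁ j₁))

lemma IsQTensor.highest_eq_cgCoeff {q : ℝ} (hq : 0 < q) (hq1 : q < 1) {j : ℚ} {T : ℚ → Op}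
    (hT : IsQTensor q j T) {J' j₁ : ℚ} (h : IsTriangle j₁ j J') (m₁ m : ℚ) :
    bra J' J' (T m (ket j₁ m₁)) =
      reducedElement q j T J' j₁ * cgCoeff q j₁ j J' 0 m₁ m := by
  by_cases hM : J' = m₁ + m
  swap
  · rw [hT.bra_ket_eq_zero hM, cgCoeff_zero_of_ne hM, mul_zero]
  by_cases hm : IsWeight j m
  swap
  · rw [cgCoeff_of_not_right hm, hT.eq_zero m hm]; simp
  by_cases hm₁ : IsWeight j₁ m₁
  swap
  · rw [cgCoeff_of_not_left hm₁, ket_of_not hm₁]; simp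
  obtain ⟨i, hi⟩ := hm₁.1
  obtain rfl : m₁ = j₁ - i := by linarith
  obtain rfl : m = J' - j₁ + i := by linarith
  have hi' : i ≤ ⌊j₁ + j - J'⌋₊ := Nat.le_floor (by have := hm.le; linarith)
  rw [hT.highest_eq hq hq1 h hi', cgCoeff_zero_of_le hi' hm₁ hm, reducedElement]
  have := (hwNorm_pos q j₁ j J').ne'
  have hne : ((hwNorm q j₁ j J' : ℝ) : ℂ) ≠ 0 := by exact_mod_cast this
  push_cast
  field_simp

/-- The difference of the two sides solves the lowering recursion and is zero at highest weight. -/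
lemma IsQTensor.eq_cgCoeff {q : ℝ} (hq : 0 < q) (hq1 : q < 1) {j : ℚ} {T : ℚ → Op}
    (hT : IsQTensor q j T) {J' j₁ : ℚ} (h : IsTriangle j₁ j J') {K k : ℕ} (hK : 2 * J' = K)
    (hk : k ≤ K) (m₁ m : ℚ) :
    bra J' (J' - k) (T m (ket j₁ m₁)) =
      reducedElement q j T J' j₁ * cgCoeff q j₁ j J' k m₁ m := by
  rw [← sub_eq_zero]
  refine eq_zero_of_lowering hq hq1 hK (D := fun k m₁ m => bra J' (J' - k) (T m (ket j₁ m₁)) -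
      reducedElement q j T J' j₁ * cgCoeff q j₁ j J' k m₁ m)
    (A := fun m₁ m => ((F q 1 j m * q ^ (-m₁ : ℝ) : ℝ) : ℂ))
    (B := fun m₁ m => ((F q 1 j₁ m₁ * q ^ (m : ℝ) : ℝ) : ℂ)) ?_ ?_ hk m₁ m
  · intro m₁ m
    rw [Nat.cast_zero, sub_zero, hT.highest_eq_cgCoeff hq hq1 h, _root_.sub_self]
  · intro k m₁ m hk
    have hk' : ((k + 1 : ℕ) : ℚ) ≤ K := by exact_mod_cast hk
    push_cast at hk'
    have hk0 : (0 : ℚ) ≤ k := by positivity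
    have hF' := (F_pos hq hq1 (s := -1) (j := J') (m := J' - k) (by linarith) (by linarith)).ne'
    have hF : ((F q (-1) J' (J' - k) : ℝ) : ℂ) ≠ 0 := by exact_mod_cast hF'
    have h1 := hT.lowering hq J' j₁ k m₁ m
    have h2 := cgCoeff_succ q j₁ j J' k m₁ m
    rw [Complex.ofReal_inv, eq_inv_mul_iff_mul_eq₀ hF] at h2
    linear_combination h1 - reducedElement q j T J' j₁ * h2

/-- If `J'` is too small for the triangle condition, the chain `m₁ + m = J'` runs past one end of
the weights of rank `j` or of `V_{j₁}`, where the matrix element is zero; the two-term recursion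
carries this zero along the chain. `J' > j₁ + j` cannot occur, as `J'` is a sum of two weights. -/
lemma IsQTensor.highest_eq_zero {q : ℝ} (hq : 0 < q) (hq1 : q < 1) {j : ℚ} {T : ℚ → Op}
    (hT : IsQTensor q j T) {J' j₁ : ℚ} (hJ : 0 ≤ J') (h : ¬ IsTriangle j₁ j J') (m₁ m : ℚ) :
    bra J' J' (T m (ket j₁ m₁)) = 0 := by
  by_cases hM : J' = m₁ + m
  swap
  · exact hT.bra_ket_eq_zero hM
  by_cases hw : IsWeight j m ∧ IsWeight j₁ m₁
  swap
  · exact bra_T_eq_zero_of_not_weight hT hw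
  obtain ⟨hm, hm₁⟩ := hw
  obtain ⟨⟨x, hx⟩, y, hy⟩ := hm
  obtain ⟨⟨z, hz⟩, w, hw⟩ := hm₁
  have key : ∀ i : ℕ, bra J' J' (T (J' - j₁ + i) (ket j₁ (j₁ - i))) = 0 := by
    rcases lt_or_ge w x with hlt | hle
    · -- `J < j - j₁`: descend from the lower end of the chain
      have hlt' : ((w + 1 : ℕ) : ℚ) ≤ x := by exact_mod_cast hlt
      push_cast at hlt'
      have hend : ∀ i, z + w < i → bra J' J' (T (J' - j₁ + i) (ket j₁ (j₁ - i))) = 0 := by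
        intro i hi
        rw [ket_of_not, map_zero, map_zero]
        intro h'
        have h1 := h'.neg_le
        have h2 : ((z + w + 1 : ℕ) : ℚ) ≤ i := by exact_mod_cast hi
        push_cast at h2
        linarith
      have hstep : ∀ d i, i + d = z + w + 1 →
          bra J' J' (T (J' - j₁ + i) (ket j₁ (j₁ - i))) = 0 := by
        intro d
        induction d with
        | zero => intro i hi; exact hend i (by omega)
        | succ d ih =>
          intro i hi
          by_cases hw' : IsWeight j (J' - j₁ + i)
          swap
          · exact bra_T_eq_zero_of_not_weight hT fun h' => hw' h'.1
          obtain ⟨b, hb⟩ := hw'.2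
          have hi' : ((i + d + 1 : ℕ) : ℚ) = (z + w + 1 : ℕ) := by exact_mod_cast hi
          push_cast at hi'
          have hd : (0 : ℚ) ≤ d := by positivity
          have hb0 : (0 : ℚ) ≤ b := by positivity
          have hm' : IsWeight j (J' - j₁ + (i + 1)) := by
            refine ⟨⟨x - w - 1 + d, ?_⟩, b + 1, by push_cast; linarith⟩
            rw [Nat.cast_add, Nat.sub_sub, Nat.cast_sub (by omega)]
            push_cast
            linarith
          have hrec := hT.highest_recursion hq (J' := J') hm'
          have h1 := ih (i + 1) (by omega)
          rw [Nat.cast_succ, ← sub_sub] at h1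
          rw [h1, mul_zero, add_zero] at hrec
          refine (mul_eq_zero.1 hrec).resolve_left ?_
          exact_mod_cast (F_pos hq hq1 (by linarith) (by linarith)).ne'
      intro i
      rcases lt_or_ge (z + w) i with hi | hi
      · exact hend i hi
      · exact hstep (z + w + 1 - i) i (by omega)
    · -- `J < j₁ - j`: ascend from the upper end of the chain
      have hlt : y < z := by
        by_contra! hyz
        refine h ⟨⟨z + x, by push_cast; linarith⟩, ⟨w - x, ?_⟩, y - z, ?_⟩
        · push_cast [Nat.cast_sub hle]; linarith
        · push_cast [Nat.cast_sub hyz]; linarith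
      have hlt' : ((y + 1 : ℕ) : ℚ) ≤ z := by exact_mod_cast hlt
      push_cast at hlt'
      intro i
      induction i with
      | zero =>
        refine bra_T_eq_zero_of_not_weight hT fun h' => ?_
        have := h'.1.neg_le
        push_cast at this
        linarith
      | succ i ih =>
        by_cases hw' : IsWeight j (J' - j₁ + (i + 1 : ℕ)) ∧ IsWeight j₁ (j₁ - (i + 1 : ℕ))
        swap
        · exact bra_T_eq_zero_of_not_weight hT hw'
        push_cast at hw' ⊢
        have hrec := hT.highest_recursion hq (J' := J') hw'.1
        rw [ih, mul_zero, zero_add, sub_sub] at hrec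
        refine (mul_eq_zero.1 hrec).resolve_left ?_
        have h1 := hw'.2.neg_le
        have hi0 : (0 : ℚ) ≤ i := by positivity
        have hF : 0 < F q 1 j₁ (j₁ - (i + 1)) := F_pos hq hq1 (by linarith) (by linarith)
        have hQ : 0 < q ^ ((J' + 1 : ℚ) : ℝ) := Real.rpow_pos_of_pos hq _
        exact_mod_cast (mul_pos hF hQ).ne'
  have := key z
  rwa [show J' - j₁ + z = m by linarith, show j₁ - z = m₁ by linarith] at this

/-- Lowering propagates the vanishing at highest weight to every weight of spin `J'`. -/
lemma IsQTensor.eq_zero_of_not_triangle {q : ℝ} (hq : 0 < q) (hq1 : q < 1) {j : ℚ}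
    {T : ℚ → Op} (hT : IsQTensor q j T) {J' M j₁ : ℚ} (hJ : IsWeight J' M)
    (h : ¬ IsTriangle j₁ j J') (m₁ m : ℚ) : bra J' M (T m (ket j₁ m₁)) = 0 := by
  have h0 := hJ.nonneg
  obtain ⟨⟨k, hk⟩, b, hb⟩ := hJ
  obtain rfl : M = J' - k := by linarith
  exact eq_zero_of_lowering hq hq1 (K := k + b) (by push_cast; linarith)
    (D := fun k m₁ m => bra J' (J' - k) (T m (ket j₁ m₁)))
    (by simpa using hT.highest_eq_zero hq hq1 h0 h)
    (fun k m₁ m _ => hT.lowering hq J' j₁ k m₁ m) (by omega) m₁ m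

lemma IsQTensor.wignerEckart {q : ℝ} (hq : 0 < q) (hq1 : q < 1) {n : ℕ} {T : ℚ → Op}
    (hT : IsQTensor q ((n : ℚ) / 2) T) :
    QWignerEckart q n T fun J' j₁ => (-1 : ℂ) ^ n *
      ((Real.sqrt (qNum q ((2 * J' + 1 : ℚ) : ℝ)) : ℝ) : ℂ) *
        reducedElement q ((n : ℚ) / 2) T J' j₁ := by
  intro J' M m j₁ m₁ hJ hm hm₁
  set j : ℚ := (n : ℚ) / 2
  by_cases h : IsTriangle j₁ j J'
  swap
  · rw [qCG, if_neg fun h' => h h'.1, mul_zero, hT.eq_zero_of_not_triangle hq hq1 hJ h]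
  rw [qCG, if_pos ⟨h, hJ⟩]
  have h0 := hJ.nonneg
  obtain ⟨⟨k, hk⟩, b, hb⟩ := hJ
  obtain rfl : M = J' - k := by linarith
  rw [hT.eq_cgCoeff hq hq1 h (K := k + b) (by push_cast; linarith) (by omega), hk,
    Nat.floor_natCast, ← cgCoeff]
  have hne : ((Real.sqrt (qNum q ((2 * J' + 1 : ℚ) : ℝ)) : ℝ) : ℂ) ≠ 0 := by
    exact_mod_cast (Real.sqrt_pos.2 (qNum_pos hq hq1
      (by exact_mod_cast (by linarith : (0 : ℚ) < 2 * J' + 1)))).ne'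
  have hs : (-1 : ℂ) ^ n * (-1 : ℂ) ^ n = 1 := by rw [← mul_pow]; simp
  rw [mul_div_right_comm, mul_div_assoc, div_self hne, mul_one]
  linear_combination -(reducedElement q j T J' j₁ * cgCoeff q j₁ j J' k m₁ m) * hs

/-! ### Asymptotics as `q → 0⁺` -/

lemma eventually_mem_Ioo : ∀ᶠ q in 𝓝[>] (0 : ℝ), 0 < q ∧ q < 1 :=
  Ioo_mem_nhdsGT one_pos

lemma tendsto_rpow_of_pos {e : ℝ} (he : 0 < e) :
    Tendsto (fun q : ℝ => q ^ e) (𝓝[>] (0 : ℝ)) (𝓝 0) := by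
  have h := (Real.continuousAt_rpow_const 0 e (.inr he.le)).tendsto
  rw [Real.zero_rpow he.ne'] at h
  exact h.mono_left nhdsWithin_le_nhds

lemma tendsto_rpow_of_nonneg {e : ℚ} (he : 0 ≤ e) :
    Tendsto (fun q : ℝ => q ^ (e : ℝ)) (𝓝[>] (0 : ℝ)) (𝓝 (if e = 0 then 1 else 0)) := by
  split_ifs with h
  · simp [h]
  · exact tendsto_rpow_of_pos (by exact_mod_cast lt_of_le_of_ne he (Ne.symm h))

/-- `[x] q^(x-1) = (q^(2x) - 1) / (q^2 - 1)`. -/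
lemma tendsto_qNum_mul_rpow {x : ℝ} (hx : 0 < x) :
    Tendsto (fun q : ℝ => qNum q x * q ^ (x - 1)) (𝓝[>] (0 : ℝ)) (𝓝 1) := by
  have h : Tendsto (fun q : ℝ => (q ^ (2 * x) - 1) / (q ^ (2 : ℝ) - 1)) (𝓝[>] (0 : ℝ))
      (𝓝 ((0 - 1) / (0 - 1))) :=
    ((tendsto_rpow_of_pos (by linarith)).sub_const 1).div
      ((tendsto_rpow_of_pos two_pos).sub_const 1) (by norm_num)
  rw [div_self (by norm_num)] at h
  refine h.congr' ?_
  filter_upwards [eventually_mem_Ioo] with q ⟨hq, hq1⟩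
  have hq2 : q ^ (2 : ℝ) = q * q := by rw [Real.rpow_two, sq]
  have e1 : q ^ (2 * x) = q ^ x * q ^ x := by rw [← Real.rpow_add hq]; ring_nf
  have e2 : q ^ (x - 1) = q ^ x / q := by rw [Real.rpow_sub hq, Real.rpow_one]
  have e3 : q ^ x ≠ 0 := (Real.rpow_pos_of_pos hq _).ne'
  have e4 : q * q - 1 ≠ 0 := by nlinarith
  have e5 : q - q⁻¹ = (q * q - 1) / q := by field_simp
  rw [qNum, hq2, e1, e2, e5, Real.rpow_neg hq.le]
  field_simp

/-- One bracket is nonpositive and the other nonnegative, and `Real.sqrt` is zero on nonpositive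
reals. So `F` vanishes everywhere beyond the ends, not only at the first label outside. -/
lemma F_eq_zero_of_sub_nonpos {q : ℝ} (hq : 0 < q) (hq1 : q < 1) {s j m : ℚ} (hj : 0 ≤ j)
    (h : j - s * m ≤ 0) : F q s j m = 0 := by
  refine Real.sqrt_eq_zero_of_nonpos (mul_nonpos_of_nonpos_of_nonneg ?_ (qNum_nonneg hq hq1 ?_))
  · rw [← neg_nonneg, ← qNum_neg]
    exact qNum_nonneg hq hq1 (by rw [← Rat.cast_neg]; exact_mod_cast neg_nonneg.2 h)
  · exact_mod_cast (by linarith : (0 : ℚ) ≤ j + s * m + 1)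

lemma F_eq_zero_of_add_nonpos {q : ℝ} (hq : 0 < q) (hq1 : q < 1) {s j m : ℚ} (hj : 0 ≤ j)
    (h : j + s * m + 1 ≤ 0) : F q s j m = 0 := by
  refine Real.sqrt_eq_zero_of_nonpos (mul_nonpos_of_nonneg_of_nonpos (qNum_nonneg hq hq1 ?_) ?_)
  · exact_mod_cast (by linarith : (0 : ℚ) ≤ j - s * m)
  · rw [← neg_nonneg, ← qNum_neg]
    exact qNum_nonneg hq hq1 (by rw [← Rat.cast_neg]; exact_mod_cast neg_nonneg.2 h)

/-- The two brackets contribute exponents adding up to `2j - 1`, so the rate does not depend on `m`.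
The whole limit rests on this. -/
lemma tendsto_F_of_pos {s j m : ℚ} (h1 : 0 < j - s * m) (h2 : 0 < j + s * m + 1) :
    Tendsto (fun q : ℝ => F q s j m * q ^ ((j : ℝ) - 1 / 2)) (𝓝[>] (0 : ℝ)) (𝓝 1) := by
  have h1' : (0 : ℝ) < ((j - s * m : ℚ) : ℝ) := by exact_mod_cast h1
  have h2' : (0 : ℝ) < ((j + s * m + 1 : ℚ) : ℝ) := by exact_mod_cast h2
  have h := ((tendsto_qNum_mul_rpow h1').mul (tendsto_qNum_mul_rpow h2')).sqrt
  rw [mul_one, Real.sqrt_one] at h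
  refine h.congr' ?_
  filter_upwards [eventually_mem_Ioo] with q ⟨hq, hq1⟩
  have e : q ^ ((j : ℝ) - 1 / 2) = Real.sqrt (q ^ (((j - s * m : ℚ) : ℝ) - 1) *
      q ^ (((j + s * m + 1 : ℚ) : ℝ) - 1)) := by
    symm
    rw [Real.sqrt_eq_iff_mul_self_eq_of_pos (Real.rpow_pos_of_pos hq _), ← Real.rpow_add hq,
      ← Real.rpow_add hq]
    congr 1
    push_cast
    ring
  rw [F, e, ← Real.sqrt_mul (mul_nonneg (qNum_nonneg hq hq1 h1'.le) (qNum_nonneg hq hq1 h2'.le))]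
  congr 1
  ring

lemma tendsto_F {s j m : ℚ} (hj : 0 ≤ j) :
    Tendsto (fun q : ℝ => F q s j m * q ^ ((j : ℝ) - 1 / 2)) (𝓝[>] (0 : ℝ))
      (𝓝 (if 0 < j - s * m ∧ 0 < j + s * m + 1 then 1 else 0)) := by
  split_ifs with h
  · exact tendsto_F_of_pos h.1 h.2
  · refine tendsto_const_nhds.congr' ?_
    filter_upwards [eventually_mem_Ioo] with q ⟨hq, hq1⟩
    rw [not_and_or, not_lt, not_lt] at h
    rcases h with h | h
    · rw [F_eq_zero_of_sub_nonpos hq hq1 hj h, zero_mul]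
    · rw [F_eq_zero_of_add_nonpos hq hq1 hj h, zero_mul]

/-- The limit of the recursion relation, rescaled by `q ^ (J - 1 / 2 - t)`. -/
lemma limit_recursion {j : ℚ} {T : ℝ → ℚ → Op} {τ : ℚ → Op}
    (hT : ∀ᶠ q in 𝓝[>] (0 : ℝ), IsQTensor q j (T q)) (hτ : ∀ m, OpTendsto (fun q => T q m) (τ m))
    {s : ℚ} (hs : s = 1 ∨ s = -1) {J' m j₁ m₁ t : ℚ} (hJ : 0 ≤ J') (hj₁ : 0 ≤ j₁)
    (hm : IsWeight j m) (ht : t ≤ 0) (ht1 : t ≤ J' - j - m₁) (ht2 : t ≤ J' - j₁ + m) :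
    (if 0 < J' - s * (m₁ + m) ∧ 0 < J' + s * (m₁ + m) + 1 ∧ t = 0 then
        bra J' (m₁ + m) (τ m (ket j₁ m₁)) else 0) =
      (if 0 < j - s * m ∧ 0 < j + s * m + 1 ∧ J' - j - m₁ = t then
        bra J' (m₁ + m + s) (τ (m + s) (ket j₁ m₁)) else 0) +
      (if 0 < j₁ - s * m₁ ∧ 0 < j₁ + s * m₁ + 1 ∧ J' - j₁ + m = t then
        bra J' (m₁ + m + s) (τ m (ket j₁ (m₁ + s))) else 0) := by
  have key : ∀ {P Q : Prop} [Decidable P] [Decidable Q] {e : ℚ} {f : ℝ → ℝ} {g : ℝ → ℂ} {c : ℂ},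
      0 ≤ e → Tendsto f (𝓝[>] (0 : ℝ)) (𝓝 (if P ∧ Q then 1 else 0)) →
      Tendsto g (𝓝[>] (0 : ℝ)) (𝓝 c) →
      Tendsto (fun q => ((f q * q ^ (e : ℝ) : ℝ) : ℂ) * g q) (𝓝[>] (0 : ℝ))
        (𝓝 (if P ∧ Q ∧ e = 0 then c else 0)) := by
    intro P Q _ _ e f g c he hf hg
    have h := ((Complex.continuous_ofReal.tendsto _).comp
      (hf.mul (tendsto_rpow_of_nonneg he))).mul hg
    have heq : (if P ∧ Q ∧ e = 0 then c else 0) =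
        (((if P ∧ Q then 1 else 0) * (if e = 0 then 1 else 0) : ℝ) : ℂ) * c := by
      by_cases hP : P <;> by_cases hQ : Q <;> by_cases h0 : e = 0 <;> simp [hP, hQ, h0]
    rw [heq]
    exact h
  -- Once each `F` is paired with its own normalising power, the exponents left over are `-t`, `J' -
  -- j - m₁ - t` and `J' - j₁ + m - t`; the bounds on `t` make them nonnegative.
  have hl := key (e := -t) (by linarith) (tendsto_F (s := s) (m := m₁ + m) hJ)
    (hτ m J' (m₁ + m) j₁ m₁)
  have hr1 := key (e := J' - j - m₁ - t) (by linarith) (tendsto_F (s := s) (m := m) hm.nonneg)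
    (hτ (m + s) J' (m₁ + m + s) j₁ m₁)
  have hr2 := key (e := J' - j₁ + m - t) (by linarith) (tendsto_F (s := s) (m := m₁) hj₁)
    (hτ m J' (m₁ + m + s) j₁ (m₁ + s))
  simp only [neg_eq_zero, sub_eq_zero (b := t)] at hl hr1 hr2
  refine tendsto_nhds_unique hl ((hr1.add hr2).congr' ?_)
  filter_upwards [eventually_mem_Ioo, hT] with q ⟨hq, hq1⟩ hTq
  have hrec := hTq.recursion hq hs (J' := J') (j₁ := j₁) (m₁ := m₁) hm
  set z : ℝ := q ^ ((J' : ℝ) - 1 / 2 - t)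
  have e0 : F q s J' (m₁ + m) * q ^ ((J' : ℝ) - 1 / 2) * q ^ ((-t : ℚ) : ℝ) =
      z * F q s J' (m₁ + m) := by
    rw [mul_assoc, ← Real.rpow_add hq, mul_comm]
    congr 2
    push_cast
    ring
  have e1 : F q s j m * q ^ ((j : ℝ) - 1 / 2) * q ^ ((J' - j - m₁ - t : ℚ) : ℝ) =
      z * (F q s j m * q ^ (-m₁ : ℝ)) := by
    rw [mul_assoc, ← Real.rpow_add hq, mul_left_comm, ← Real.rpow_add hq]
    congr 2
    push_cast
    ring
  have e2 : F q s j₁ m₁ * q ^ ((j₁ : ℝ) - 1 / 2) * q ^ ((J' - j₁ + m - t : ℚ) : ℝ) =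
      z * (F q s j₁ m₁ * q ^ (m : ℝ)) := by
    rw [mul_assoc, ← Real.rpow_add hq, mul_left_comm, ← Real.rpow_add hq]
    congr 2
    push_cast
    ring
  rw [e0, e1, e2]
  simp only [Complex.ofReal_mul] at hrec ⊢
  linear_combination -(z : ℂ) * hrec

/-! ### Combinatorics of the limiting relations on the rectangle -/

section Chain

variable {p n α : ℤ} {x : ℤ → ℤ → ℂ}

/-- The limiting recursion relations on the rectangle `0 ≤ a ≤ p`, `0 ≤ b ≤ n`. -/
structure LimitRelations (p n α : ℤ) (x : ℤ → ℤ → ℂ) : Prop where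
  up : ∀ a b t : ℤ, 0 ≤ a → a ≤ p → 0 ≤ b → b ≤ n → t ≤ 0 → t ≤ a - α → t ≤ b - α →
    (if 0 < n - α + a - b ∧ 0 < p - α - a + b + 1 ∧ t = 0 then x a b else 0) =
      (if b < n ∧ a - α = t then x a (b + 1) else 0) +
      (if 0 < a ∧ b - α = t then x (a - 1) b else 0)
  down : ∀ a b t : ℤ, 0 ≤ a → a ≤ p → 0 ≤ b → b ≤ n → t ≤ 0 → t ≤ a - α → t ≤ b - α →
    (if 0 < p - α - a + b ∧ 0 < n - α + a - b + 1 ∧ t = 0 then x a b else 0) =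
      (if 0 < b ∧ a - α = t then x a (b - 1) else 0) +
      (if a < p ∧ b - α = t then x (a + 1) b else 0)

namespace LimitRelations

/-- Taking `t = b - α < 0` in `up` at `(a + 1, b)` isolates the term in `x a b`, all other exponents
being strictly larger. -/
lemma eq_zero_of_lt_right (h : LimitRelations p n α x) {a b : ℤ} (hb0 : 0 ≤ b) (hbn : b ≤ n)
    (hb : b < α) (hba : b ≤ a) (ha : a < p) : x a b = 0 := by
  have := h.up (a + 1) b (b - α) (by omega) (by omega) hb0 hbn (by omega) (by omega) (by omega)
  rw [if_neg (by omega), if_neg (by omega), if_pos (by omega), add_sub_cancel_right] at this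
  simpa using this.symm

lemma eq_zero_of_lt_left (h : LimitRelations p n α x) {a b : ℤ} (ha0 : 0 ≤ a) (hap : a ≤ p)
    (ha : a < α) (hab : a ≤ b) (hb : b < n) : x a b = 0 := by
  have := h.down a (b + 1) (a - α) ha0 hap (by omega) (by omega) (by omega) (by omega) (by omega)
  rw [if_neg (by omega), if_pos (by omega), if_neg (by omega), add_sub_cancel_right] at this
  simpa using this.symm

lemma eq_zero (h : LimitRelations p n α x) (hp : α ≤ p) (hn : α ≤ n) {a b : ℤ} (ha0 : 0 ≤ a)
    (hap : a ≤ p) (hb0 : 0 ≤ b) (hbn : b ≤ n) (hab : min a b ≠ α) : x a b = 0 := by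
  rcases lt_or_gt_of_ne hab with hlt | hgt
  · rcases le_total a b with hle | hle
    · have ha : a < α := by omega
      rcases lt_or_ge b n with hb | hb
      · exact h.eq_zero_of_lt_left ha0 hap ha hle hb
      -- On the edge `b = n` there is no point above to use, so `up` is applied below it; its other
      -- possible term is already known to vanish.
      · have := h.up a (b - 1) (a - α) ha0 hap (by omega) (by omega) (by omega) (by omega)
          (by omega)
        rw [if_neg (by omega), if_pos (by omega), sub_add_cancel] at this
        by_cases h1 : 0 < a ∧ b - 1 - α = a - α
        · rw [if_pos h1, h.eq_zero_of_lt_left (a := a - 1) (b := b - 1) (by omega) (by omega)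
            (by omega) (by omega) (by omega), add_zero] at this
          exact this.symm
        · rw [if_neg h1, add_zero] at this
          exact this.symm
    · have hb : b < α := by omega
      rcases lt_or_ge a p with ha | ha
      · exact h.eq_zero_of_lt_right hb0 hbn hb hle ha
      · have := h.down (a - 1) b (b - α) (by omega) (by omega) hb0 hbn (by omega) (by omega)
          (by omega)
        rw [if_neg (by omega), if_pos (c := a - 1 < p ∧ _) (by omega), sub_add_cancel] at this
        by_cases h1 : 0 < b ∧ a - 1 - α = b - α
        · rw [if_pos h1, h.eq_zero_of_lt_right (a := a - 1) (b := b - 1) (by omega) (by omega)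
            (by omega) (by omega) (by omega), zero_add] at this
          exact this.symm
        · rw [if_neg h1, zero_add] at this
          exact this.symm
  -- Here both exponents on the right are positive, so only the left side survives at `t = 0`.
  · have := h.up a b 0 ha0 hap hb0 hbn le_rfl (by omega) (by omega)
    rw [if_pos (by omega), if_neg (by omega), if_neg (by omega), add_zero] at this
    exact this

/-- At `t = 0` the relation `up` equates neighbours on the hook: down the column `a = α` from `(α,
n)` to the corner `(α, α)`, then along the row `b = α`. At the corner the extra term `x (α - 1) α`
vanishes. -/
lemma eq_top (h : LimitRelations p n α x) (hα : 0 ≤ α) (hp : α ≤ p) (hn : α ≤ n) {a b : ℤ}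
    (hap : a ≤ p) (hbn : b ≤ n) (hab : min a b = α) : x a b = x α n := by
  have h1 : ∀ d : ℕ, d ≤ n - α → x α (n - d) = x α n := by
    intro d
    induction d with
    | zero => simp
    | succ d ih =>
      intro hd
      push_cast at hd ⊢
      have := h.up α (n - (d + 1)) 0 hα hp (by omega) (by omega) le_rfl (by omega) (by omega)
      rw [if_pos (by omega), if_pos (by omega), show n - ((d : ℤ) + 1) + 1 = n - d by ring,
        ih (by omega)] at this
      rw [this]
      split_ifs with h1
      · rw [h.eq_zero_of_lt_left (a := α - 1) (by omega) (by omega) (by omega) (by omega)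
          (by omega), add_zero]
      · rw [add_zero]
  have h2 : ∀ d : ℕ, α + d ≤ p → x (α + d) α = x α n := by
    intro d
    induction d with
    | zero =>
      intro _
      have := h1 (n - α).toNat (by omega)
      rw [show n - ((n - α).toNat : ℤ) = α by omega] at this
      simpa using this
    | succ d ih =>
      intro hd
      push_cast at hd ⊢
      have := h.up (α + (d + 1)) α 0 (by omega) (by omega) hα hn le_rfl (by omega) (by omega)
      rw [if_pos (by omega), if_neg (by omega), if_pos (by omega), zero_add,
        show α + ((d : ℤ) + 1) - 1 = α + d by ring, ih (by omega)] at this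
      exact this
  rcases le_total a b with hle | hle
  · have := h1 (n - b).toNat (by omega)
    rw [show n - ((n - b).toNat : ℤ) = b by omega] at this
    rw [show a = α by omega, this]
  · have := h2 (a - α).toNat (by omega)
    rw [show α + ((a - α).toNat : ℤ) = a by omega] at this
    rw [show b = α by omega, this]

end LimitRelations

end Chain

/-- `limit_recursion` in the coordinates `a`, `b` with `J' = j₁ + j - α`, where the exponents become
`a - α` and `b - α`. The bound on `α` says that `J' ≥ 0`. -/
lemma limitRelations {n : ℕ} {T : ℝ → ℚ → Op} {τ : ℚ → Op}
    (hT : ∀ᶠ q in 𝓝[>] (0 : ℝ), IsQTensor q ((n : ℚ) / 2) (T q))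
    (hτ : ∀ m, OpTendsto (fun q => T q m) (τ m)) (p : ℕ) {α : ℤ} (hα : 2 * α ≤ p + n) :
    LimitRelations p n α fun a b =>
      bra ((p : ℚ) / 2 + (n : ℚ) / 2 - α) (((p : ℚ) / 2 - a) + (b - (n : ℚ) / 2))
        (τ (b - (n : ℚ) / 2) (ket ((p : ℚ) / 2) ((p : ℚ) / 2 - a))) := by
  have hα' : (2 : ℚ) * α ≤ p + n := by exact_mod_cast hα
  have hJ : (0 : ℚ) ≤ (p : ℚ) / 2 + (n : ℚ) / 2 - α := by linarith
  have hp : (0 : ℚ) ≤ (p : ℚ) / 2 := by positivity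
  constructor
  · intro a b t ha0 hap hb0 hbn ht ht1 ht2
    have ht1' : (t : ℚ) ≤ a - α := by exact_mod_cast ht1
    have ht2' : (t : ℚ) ≤ b - α := by exact_mod_cast ht2
    have h := limit_recursion hT hτ (s := 1) (.inl rfl) (m := b - (n : ℚ) / 2)
      (m₁ := (p : ℚ) / 2 - a) (t := t) hJ hp (isWeight_half_iff'.2 ⟨hb0, hbn⟩)
      (by exact_mod_cast ht) (by linarith) (by linarith)
    have hc1 : (0 < (p : ℚ) / 2 + (n : ℚ) / 2 - α - 1 * ((p : ℚ) / 2 - a + (b - (n : ℚ) / 2)) ∧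
        0 < (p : ℚ) / 2 + (n : ℚ) / 2 - α + 1 * ((p : ℚ) / 2 - a + (b - (n : ℚ) / 2)) + 1 ∧
        (t : ℚ) = 0) ↔ (0 < n - α + a - b ∧ 0 < p - α - a + b + 1 ∧ t = 0) := by
      rw [show (p : ℚ) / 2 + (n : ℚ) / 2 - α - 1 * ((p : ℚ) / 2 - a + (b - (n : ℚ) / 2)) =
          ((n - α + a - b : ℤ) : ℚ) by push_cast; ring,
        show (p : ℚ) / 2 + (n : ℚ) / 2 - α + 1 * ((p : ℚ) / 2 - a + (b - (n : ℚ) / 2)) + 1 =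
          ((p - α - a + b + 1 : ℤ) : ℚ) by push_cast; ring]
      norm_cast
    have hc2 : (0 < (n : ℚ) / 2 - 1 * (b - (n : ℚ) / 2) ∧
        0 < (n : ℚ) / 2 + 1 * (b - (n : ℚ) / 2) + 1 ∧
        (p : ℚ) / 2 + (n : ℚ) / 2 - α - (n : ℚ) / 2 - ((p : ℚ) / 2 - a) = t) ↔
        (b < n ∧ a - α = t) := by
      rw [show (n : ℚ) / 2 - 1 * (b - (n : ℚ) / 2) = ((n - b : ℤ) : ℚ) by push_cast; ring,
        show (n : ℚ) / 2 + 1 * (b - (n : ℚ) / 2) + 1 = ((b + 1 : ℤ) : ℚ) by push_cast; ring,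
        show (p : ℚ) / 2 + (n : ℚ) / 2 - α - (n : ℚ) / 2 - ((p : ℚ) / 2 - a) =
          ((a - α : ℤ) : ℚ) by push_cast; ring, Int.cast_pos, Int.cast_pos, Int.cast_inj]
      omega
    have hc3 : (0 < (p : ℚ) / 2 - 1 * ((p : ℚ) / 2 - a) ∧
        0 < (p : ℚ) / 2 + 1 * ((p : ℚ) / 2 - a) + 1 ∧
        (p : ℚ) / 2 + (n : ℚ) / 2 - α - (p : ℚ) / 2 + (b - (n : ℚ) / 2) = t) ↔
        (0 < a ∧ b - α = t) := by
      rw [show (p : ℚ) / 2 - 1 * ((p : ℚ) / 2 - a) = (a : ℚ) by ring,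
        show (p : ℚ) / 2 + 1 * ((p : ℚ) / 2 - a) + 1 = ((p - a + 1 : ℤ) : ℚ) by push_cast; ring,
        show (p : ℚ) / 2 + (n : ℚ) / 2 - α - (p : ℚ) / 2 + (b - (n : ℚ) / 2) =
          ((b - α : ℤ) : ℚ) by push_cast; ring, Int.cast_pos, Int.cast_pos, Int.cast_inj]
      omega
    rw [if_congr hc1 rfl rfl, if_congr hc2 rfl rfl, if_congr hc3 rfl rfl] at h
    rw [show ((b + 1 : ℤ) : ℚ) - (n : ℚ) / 2 = b - (n : ℚ) / 2 + 1 by push_cast; ring,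
      show (p : ℚ) / 2 - ((a - 1 : ℤ) : ℚ) = (p : ℚ) / 2 - a + 1 by push_cast; ring,
      ← add_assoc, add_right_comm _ (1 : ℚ)]
    exact h
  · intro a b t ha0 hap hb0 hbn ht ht1 ht2
    have ht1' : (t : ℚ) ≤ a - α := by exact_mod_cast ht1
    have ht2' : (t : ℚ) ≤ b - α := by exact_mod_cast ht2
    have h := limit_recursion hT hτ (s := -1) (.inr rfl) (m := b - (n : ℚ) / 2)
      (m₁ := (p : ℚ) / 2 - a) (t := t) hJ hp (isWeight_half_iff'.2 ⟨hb0, hbn⟩)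
      (by exact_mod_cast ht) (by linarith) (by linarith)
    have hc1 : (0 < (p : ℚ) / 2 + (n : ℚ) / 2 - α - -1 * ((p : ℚ) / 2 - a + (b - (n : ℚ) / 2)) ∧
        0 < (p : ℚ) / 2 + (n : ℚ) / 2 - α + -1 * ((p : ℚ) / 2 - a + (b - (n : ℚ) / 2)) + 1 ∧
        (t : ℚ) = 0) ↔ (0 < p - α - a + b ∧ 0 < n - α + a - b + 1 ∧ t = 0) := by
      rw [show (p : ℚ) / 2 + (n : ℚ) / 2 - α - -1 * ((p : ℚ) / 2 - a + (b - (n : ℚ) / 2)) =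
          ((p - α - a + b : ℤ) : ℚ) by push_cast; ring,
        show (p : ℚ) / 2 + (n : ℚ) / 2 - α + -1 * ((p : ℚ) / 2 - a + (b - (n : ℚ) / 2)) + 1 =
          ((n - α + a - b + 1 : ℤ) : ℚ) by push_cast; ring]
      norm_cast
    have hc2 : (0 < (n : ℚ) / 2 - -1 * (b - (n : ℚ) / 2) ∧
        0 < (n : ℚ) / 2 + -1 * (b - (n : ℚ) / 2) + 1 ∧
        (p : ℚ) / 2 + (n : ℚ) / 2 - α - (n : ℚ) / 2 - ((p : ℚ) / 2 - a) = t) ↔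
        (0 < b ∧ a - α = t) := by
      rw [show (n : ℚ) / 2 - -1 * (b - (n : ℚ) / 2) = (b : ℚ) by ring,
        show (n : ℚ) / 2 + -1 * (b - (n : ℚ) / 2) + 1 = ((n - b + 1 : ℤ) : ℚ) by push_cast; ring,
        show (p : ℚ) / 2 + (n : ℚ) / 2 - α - (n : ℚ) / 2 - ((p : ℚ) / 2 - a) =
          ((a - α : ℤ) : ℚ) by push_cast; ring, Int.cast_pos, Int.cast_pos, Int.cast_inj]
      omega
    have hc3 : (0 < (p : ℚ) / 2 - -1 * ((p : ℚ) / 2 - a) ∧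
        0 < (p : ℚ) / 2 + -1 * ((p : ℚ) / 2 - a) + 1 ∧
        (p : ℚ) / 2 + (n : ℚ) / 2 - α - (p : ℚ) / 2 + (b - (n : ℚ) / 2) = t) ↔
        (a < p ∧ b - α = t) := by
      rw [show (p : ℚ) / 2 - -1 * ((p : ℚ) / 2 - a) = ((p - a : ℤ) : ℚ) by push_cast; ring,
        show (p : ℚ) / 2 + -1 * ((p : ℚ) / 2 - a) + 1 = ((a + 1 : ℤ) : ℚ) by push_cast; ring,
        show (p : ℚ) / 2 + (n : ℚ) / 2 - α - (p : ℚ) / 2 + (b - (n : ℚ) / 2) =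
          ((b - α : ℤ) : ℚ) by push_cast; ring, Int.cast_pos, Int.cast_pos, Int.cast_inj]
      omega
    rw [if_congr hc1 rfl rfl, if_congr hc2 rfl rfl, if_congr hc3 rfl rfl] at h
    rw [show ((b - 1 : ℤ) : ℚ) - (n : ℚ) / 2 = b - (n : ℚ) / 2 + -1 by push_cast; ring,
      show (p : ℚ) / 2 - ((a + 1 : ℤ) : ℚ) = (p : ℚ) / 2 - a + -1 by push_cast; ring,
      ← add_assoc, add_right_comm _ (-1 : ℚ)]
    exact h

/-! ### Crystal tensors -/

lemma bra_JTilde {s J' M : ℚ} (h : IsWeight J' (M + s)) (x : H) :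
    bra J' (M + s) (JTilde s x) = bra J' M x := by
  refine LinearMap.congr_fun (f := bra J' (M + s) ∘ₗ JTilde s) (linearMap_ext_ket ?_) x
  intro j m hm
  rw [LinearMap.comp_apply, JTilde_ket s hm]
  by_cases h' : J' = j ∧ M = m
  · obtain ⟨rfl, rfl⟩ := h'
    rw [bra_ket_self h, bra_ket_self hm]
  · rw [bra_ket_of_ne h', bra_ket_of_ne (by simpa using h')]

lemma ket_ne_zero_iff {j m : ℚ} : ket j m ≠ 0 ↔ IsWeight j m := by
  constructor
  · contrapose!
    exact ket_of_not
  · intro h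
    rw [ket_of h]
    simp

/-- The vector `τ_m |j₁ m₁⟩`, labelled by `p = 2 j₁`, `a = j₁ - m₁` and `b = j + m`. -/
def tensorKet (n : ℕ) (τ : ℚ → Op) (p : ℕ) (a b : ℤ) : H :=
  τ (b - (n : ℚ) / 2) (ket ((p : ℚ) / 2) ((p : ℚ) / 2 - a))

/-- The vector `|j₁ + j - α, m₁ + m⟩`, in the labelling of `tensorKet`. -/
def targetKet (n p : ℕ) (α a b : ℤ) : H :=
  ket ((p : ℚ) / 2 + (n : ℚ) / 2 - α) ((p : ℚ) / 2 - a + (b - (n : ℚ) / 2))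

lemma isWeight_target_iff {n p : ℕ} {α a b : ℤ} :
    IsWeight ((p : ℚ) / 2 + (n : ℚ) / 2 - α) ((p : ℚ) / 2 - a + (b - (n : ℚ) / 2)) ↔
      0 ≤ n - α + a - b ∧ 0 ≤ p - α - a + b := by
  have e1 : (p : ℚ) / 2 + (n : ℚ) / 2 - α - ((p : ℚ) / 2 - a + (b - (n : ℚ) / 2)) =
      ((n - α + a - b : ℤ) : ℚ) := by push_cast; ring
  have e2 : (p : ℚ) / 2 + (n : ℚ) / 2 - α + ((p : ℚ) / 2 - a + (b - (n : ℚ) / 2)) =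
      ((p - α - a + b : ℤ) : ℚ) := by push_cast; ring
  have e3 : ∀ z : ℤ, (∃ k : ℕ, (z : ℚ) = k) ↔ 0 ≤ z := by
    intro z
    constructor
    · rintro ⟨k, hk⟩
      have : z = k := by exact_mod_cast hk
      omega
    · intro hz
      lift z to ℕ using hz
      exact ⟨z, by simp⟩
  rw [IsWeight, e1, e2, e3, e3]

lemma JTilde_lower_ket {p : ℕ} {a : ℤ} (h0 : 0 ≤ a) (hp : a ≤ p) :
    JTilde (-1) (ket ((p : ℚ) / 2) ((p : ℚ) / 2 - a)) =
      ket ((p : ℚ) / 2) ((p : ℚ) / 2 - (a + 1 : ℤ)) := by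
  rw [JTilde_ket _ (isWeight_half_iff.2 ⟨h0, hp⟩)]
  congr 1
  push_cast
  ring

lemma JTilde_raise_ket {p : ℕ} {a : ℤ} (h0 : 0 ≤ a) (hp : a ≤ p) :
    JTilde 1 (ket ((p : ℚ) / 2) ((p : ℚ) / 2 - a)) =
      ket ((p : ℚ) / 2) ((p : ℚ) / 2 - (a - 1 : ℤ)) := by
  rw [JTilde_ket _ (isWeight_half_iff.2 ⟨h0, hp⟩)]
  congr 1
  push_cast
  ring

lemma JTilde_lower_pow_ket {p : ℕ} {a : ℤ} (h0 : 0 ≤ a) (k : ℕ) :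
    (JTilde (-1) ^ k) (ket ((p : ℚ) / 2) ((p : ℚ) / 2 - a)) =
      ket ((p : ℚ) / 2) ((p : ℚ) / 2 - (a + k : ℤ)) := by
  induction k with
  | zero => simp
  | succ k ih =>
    rw [pow_succ', Module.End.mul_apply, ih]
    by_cases h : a + k ≤ p
    · rw [JTilde_lower_ket (by omega) h, Nat.cast_succ, add_assoc]
    · rw [ket_of_not (mt isWeight_half_iff.1 (by omega)), map_zero,
        ket_of_not (mt isWeight_half_iff.1 (by omega))]

lemma JTilde_raise_pow_ket {p : ℕ} {a : ℤ} (hp : a ≤ p) (k : ℕ) :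
    (JTilde 1 ^ k) (ket ((p : ℚ) / 2) ((p : ℚ) / 2 - a)) =
      ket ((p : ℚ) / 2) ((p : ℚ) / 2 - (a - k : ℤ)) := by
  induction k with
  | zero => simp
  | succ k ih =>
    rw [pow_succ', Module.End.mul_apply, ih]
    by_cases h : 0 ≤ a - k
    · rw [JTilde_raise_ket h (by omega), Nat.cast_succ, sub_sub]
    · rw [ket_of_not (mt isWeight_half_iff.1 (by omega)), map_zero,
        ket_of_not (mt isWeight_half_iff.1 (by omega))]

lemma cast_sub_half (n : ℕ) (b : ℤ) :
    (b : ℚ) - (n : ℚ) / 2 = (n : ℚ) / 2 - ((n - b : ℤ) : ℚ) := by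
  push_cast
  ring

/-- The power `k` works exactly when `a < k ≤ b`. -/
lemma lower_condition_iff {p n : ℕ} {a b : ℤ} (ha0 : 0 ≤ a) (hap : a ≤ p)
    (hbn : b ≤ n) :
    (∃ k : ℕ, 1 ≤ k ∧ (JTilde (-1) ^ k) (ket ((n : ℚ) / 2) (b - (n : ℚ) / 2)) ≠ 0 ∧
      (JTilde 1 ^ k) (ket ((p : ℚ) / 2) ((p : ℚ) / 2 - a)) = 0) ↔ a < b := by
  have h0 : ∀ j m, ket j m = 0 ↔ ¬ IsWeight j m := fun j m => by
    rw [← ket_ne_zero_iff, not_not]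
  simp only [cast_sub_half, JTilde_lower_pow_ket (p := n) (a := n - b) (by omega),
    JTilde_raise_pow_ket hap, ket_ne_zero_iff, h0, isWeight_half_iff]
  constructor
  · rintro ⟨k, h1, h2, h3⟩
    omega
  · intro h
    exact ⟨a.toNat + 1, by omega, by omega, by omega⟩

lemma raise_condition_iff {p n : ℕ} {a b : ℤ} (hap : a ≤ p) (hb0 : 0 ≤ b)
    (hbn : b ≤ n) :
    (∃ k : ℕ, 1 ≤ k ∧ (JTilde 1 ^ k) (ket ((p : ℚ) / 2) ((p : ℚ) / 2 - a)) ≠ 0 ∧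
      (JTilde (-1) ^ k) (ket ((n : ℚ) / 2) (b - (n : ℚ) / 2)) = 0) ↔ b < a := by
  have h0 : ∀ j m, ket j m = 0 ↔ ¬ IsWeight j m := fun j m => by
    rw [← ket_ne_zero_iff, not_not]
  simp only [cast_sub_half, JTilde_lower_pow_ket (p := n) (a := n - b) (by omega),
    JTilde_raise_pow_ket hap, ket_ne_zero_iff, h0, isWeight_half_iff]
  constructor
  · rintro ⟨k, h1, h2, h3⟩
    omega
  · intro h
    exact ⟨b.toNat + 1, by omega, by omega, by omega⟩

open Classical in
/-- The transformation rules of a crystal tensor in the labelling of `tensorKet`. -/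
lemma isCrystalTensor_iff {n : ℕ} {τ : ℚ → Op} :
    IsCrystalTensor ((n : ℚ) / 2) τ ↔
      (∀ m, ¬ IsWeight ((n : ℚ) / 2) m → τ m = 0) ∧
      (∀ m, IsWeight ((n : ℚ) / 2) m → adJ3 (τ m) = (m : ℂ) • τ m) ∧
      (∀ (p : ℕ) (a b : ℤ), 0 ≤ a → a ≤ p → 0 ≤ b → b ≤ n →
        JTilde (-1) (tensorKet n τ p a b) =
          if a < b then tensorKet n τ p a (b - 1) else tensorKet n τ p (a + 1) b) ∧
      (∀ (p : ℕ) (a b : ℤ), 0 ≤ a → a ≤ p → 0 ≤ b → b ≤ n →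
        JTilde 1 (tensorKet n τ p a b) =
          if b < a then tensorKet n τ p (a - 1) b else tensorKet n τ p a (b + 1)) := by
  have hl : ∀ b : ℤ, (b : ℚ) - (n : ℚ) / 2 - 1 = ((b - 1 : ℤ) : ℚ) - (n : ℚ) / 2 := by
    intro b; push_cast; ring
  have hr : ∀ b : ℤ, (b : ℚ) - (n : ℚ) / 2 + 1 = ((b + 1 : ℤ) : ℚ) - (n : ℚ) / 2 := by
    intro b; push_cast; ring
  constructor
  · rintro ⟨h1, h2, h3, h4⟩
    refine ⟨h1, h2, fun p a b ha0 hap hb0 hbn => ?_, fun p a b ha0 hap hb0 hbn => ?_⟩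
    · have := h3 _ _ _ (isWeight_half_iff'.2 ⟨hb0, hbn⟩) (isWeight_half_iff.2 ⟨ha0, hap⟩)
      rw [if_congr (lower_condition_iff ha0 hap hbn) rfl rfl, JTilde_lower_ket ha0 hap, hl]
        at this
      exact this
    · have := h4 _ _ _ (isWeight_half_iff'.2 ⟨hb0, hbn⟩) (isWeight_half_iff.2 ⟨ha0, hap⟩)
      rw [if_congr (raise_condition_iff hap hb0 hbn) rfl rfl, JTilde_raise_ket ha0 hap, hr]
        at this
      exact this
  · rintro ⟨h1, h2, h3, h4⟩
    refine ⟨h1, h2, fun m j₁ m₁ hm hm₁ => ?_, fun m j₁ m₁ hm hm₁ => ?_⟩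
    all_goals
      obtain ⟨b, hb, rfl⟩ := hm.exists_nat_add
      obtain ⟨p, a, ha, rfl, rfl⟩ := hm₁.exists_half
      have hb0 : (0 : ℤ) ≤ b := by positivity
      have ha0 : (0 : ℤ) ≤ a := by positivity
      have hb' : (b : ℤ) ≤ n := by exact_mod_cast hb
      have ha' : (a : ℤ) ≤ p := by exact_mod_cast ha
      rw [← Int.cast_natCast (R := ℚ) a, ← Int.cast_natCast (R := ℚ) b]
    · rw [if_congr (lower_condition_iff ha0 ha' hb') rfl rfl, JTilde_lower_ket ha0 ha', hl]
      exact h3 p a b ha0 ha' hb0 hb'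
    · rw [if_congr (raise_condition_iff ha' hb0 hb') rfl rfl, JTilde_raise_ket ha0 ha', hr]
      exact h4 p a b ha0 ha' hb0 hb'

/-- The amplitude from `V_{j₁}`, `j₁ = p / 2`, to `V_{j₁ + j - α}`. -/
def topAmplitude (n : ℕ) (τ : ℚ → Op) (p : ℕ) (α : ℤ) : ℂ :=
  bra ((p : ℚ) / 2 + (n : ℚ) / 2 - α) ((p : ℚ) / 2 - α + (((n : ℤ) : ℚ) - (n : ℚ) / 2))
    (tensorKet n τ p α n)

/-- `τ_m |j₁ m₁⟩` is a multiple of `|j₁ + j - α, m₁ + m⟩` with `α = min (j₁ - m₁) (j + m)`, the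
factor depending on `j₁` and `α` only. -/
def HasChainForm (n : ℕ) (τ : ℚ → Op) : Prop :=
  ∀ (p : ℕ) (a b : ℤ), 0 ≤ a → a ≤ p → 0 ≤ b → b ≤ n →
    tensorKet n τ p a b = topAmplitude n τ p (min a b) • targetKet n p (min a b) a b

lemma JTilde_lower_targetKet {n p : ℕ} {α a b : ℤ} (h1 : 0 ≤ n - α + a - b)
    (h2 : 0 ≤ p - α - a + b) :
    JTilde (-1) (targetKet n p α a b) = targetKet n p α a (b - 1) := by
  rw [targetKet, JTilde_ket _ (isWeight_target_iff.2 ⟨h1, h2⟩), targetKet]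
  congr 1
  push_cast
  ring

lemma JTilde_raise_targetKet {n p : ℕ} {α a b : ℤ} (h1 : 0 ≤ n - α + a - b)
    (h2 : 0 ≤ p - α - a + b) :
    JTilde 1 (targetKet n p α a b) = targetKet n p α a (b + 1) := by
  rw [targetKet, JTilde_ket _ (isWeight_target_iff.2 ⟨h1, h2⟩), targetKet]
  congr 1
  push_cast
  ring

lemma targetKet_succ (n p : ℕ) (α a b : ℤ) :
    targetKet n p α (a + 1) b = targetKet n p α a (b - 1) := by
  rw [targetKet, targetKet]
  congr 1
  push_cast
  ring

lemma targetKet_pred (n p : ℕ) (α a b : ℤ) :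
    targetKet n p α (a - 1) b = targetKet n p α a (b + 1) := by
  rw [targetKet, targetKet]
  congr 1
  push_cast
  ring

/-- With `b = n ≥ a`, `J̃₊` acts on the tensor factor and gives zero, so only the component whose
spin equals its weight can be nonzero. -/
lemma IsCrystalTensor.top {n : ℕ} {τ : ℚ → Op} (h : IsCrystalTensor ((n : ℚ) / 2) τ) {p : ℕ}
    {α : ℤ} (h0 : 0 ≤ α) (hp : α ≤ p) (hn : α ≤ n) :
    tensorKet n τ p α n = topAmplitude n τ p α • targetKet n p α α n := by
  obtain ⟨h1, h2, -, h4⟩ := isCrystalTensor_iff.1 h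
  have hw : IsWeight ((n : ℚ) / 2) (((n : ℤ) : ℚ) - (n : ℚ) / 2) :=
    isWeight_half_iff'.2 ⟨by omega, le_rfl⟩
  have hraise : JTilde 1 (tensorKet n τ p α n) = 0 := by
    rw [h4 p α n h0 hp (by omega) le_rfl, if_neg (by omega), tensorKet, h1]
    · simp
    · rw [isWeight_half_iff']; omega
  refine ext_bra fun J' M hJ => ?_
  rw [map_smul, targetKet]
  by_cases hM : M = (p : ℚ) / 2 - α + (((n : ℤ) : ℚ) - (n : ℚ) / 2)
  swap
  · rw [bra_ket_of_ne fun h' => hM h'.2, smul_zero]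
    exact bra_ket_eq_zero_of_adJ3 (h2 _ hw) hM
  subst hM
  by_cases hJ' : J' = (p : ℚ) / 2 + (n : ℚ) / 2 - α
  · subst hJ'
    rw [bra_ket_self hJ, smul_eq_mul, mul_one, topAmplitude]
  · rw [bra_ket_of_ne fun h' => hJ' h'.1, smul_zero]
    -- For any other spin the weight can still be raised, and `J̃₊` would preserve the component
    -- there.
    have hJ1 : IsWeight J' ((p : ℚ) / 2 - α + (((n : ℤ) : ℚ) - (n : ℚ) / 2) + 1) := by
      by_contra hno
      have := hJ.of_not_add_sign (.inl rfl) hno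
      push_cast at this
      exact hJ' (by linarith)
    rw [← bra_JTilde hJ1, hraise, map_zero]

/-- Starting from the tip `(α, n)`, `J̃₋` lowers `b` while `a < b`, then raises `a` from the corner
on, covering the whole hook. Every step also lowers the target vector by one. -/
lemma IsCrystalTensor.hasChainForm {n : ℕ} {τ : ℚ → Op} (h : IsCrystalTensor ((n : ℚ) / 2) τ) :
    HasChainForm n τ := by
  obtain ⟨-, -, h3, -⟩ := isCrystalTensor_iff.1 h
  intro p a b ha0 hap hb0 hbn
  have hα0 : 0 ≤ min a b := by omega
  have hαp : min a b ≤ p := by omega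
  have hαn : min a b ≤ n := by omega
  generalize hα : min a b = α at *
  have key1 : ∀ d : ℕ, (d : ℤ) ≤ n - α →
      tensorKet n τ p α (n - d) = topAmplitude n τ p α • targetKet n p α α (n - d) := by
    intro d
    induction d with
    | zero =>
      intro _
      rw [Nat.cast_zero, sub_zero]
      exact h.top hα0 hαp hαn
    | succ d ih =>
      intro hd
      push_cast at hd ⊢
      have := h3 p α (n - d) hα0 hαp (by omega) (by omega)
      rw [if_pos (by omega), ih (by omega), map_smul,
        JTilde_lower_targetKet (by omega) (by omega)] at this
      rw [← sub_sub, this]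
  have key2 : ∀ d : ℕ, α + d ≤ p →
      tensorKet n τ p (α + d) α = topAmplitude n τ p α • targetKet n p α (α + d) α := by
    intro d
    induction d with
    | zero =>
      intro _
      have := key1 (n - α).toNat (by omega)
      rw [show (n : ℤ) - ((n - α).toNat : ℤ) = α by omega] at this
      simpa using this
    | succ d ih =>
      intro hd
      push_cast at hd ⊢
      have := h3 p (α + d) α (by omega) (by omega) hα0 hαn
      rw [if_neg (by omega), ih (by omega), map_smul,
        JTilde_lower_targetKet (by omega) (by omega)] at this
      rw [← add_assoc, ← this, targetKet_succ]
  rcases le_total a b with hle | hle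
  · have := key1 (n - b).toNat (by omega)
    rw [show (n : ℤ) - ((n - b).toNat : ℤ) = b by omega] at this
    rw [show a = α by omega, this]
  · have := key2 (a - α).toNat (by omega)
    rw [show α + ((a - α).toNat : ℤ) = a by omega] at this
    rw [show b = α by omega, this]

lemma HasChainForm.isCrystalTensor {n : ℕ} {τ : ℚ → Op} (h : HasChainForm n τ)
    (h1 : ∀ m, ¬ IsWeight ((n : ℚ) / 2) m → τ m = 0)
    (h2 : ∀ m, IsWeight ((n : ℚ) / 2) m → adJ3 (τ m) = (m : ℂ) • τ m) :
    IsCrystalTensor ((n : ℚ) / 2) τ := by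
  refine isCrystalTensor_iff.2 ⟨h1, h2, fun p a b ha0 hap hb0 hbn => ?_,
    fun p a b ha0 hap hb0 hbn => ?_⟩
  · rw [h p a b ha0 hap hb0 hbn, map_smul, JTilde_lower_targetKet (by omega) (by omega)]
    split_ifs with hab
    · rw [h p a (b - 1) ha0 hap (by omega) (by omega), show min a (b - 1) = min a b by omega]
    · by_cases hp : a + 1 ≤ p
      · rw [h p (a + 1) b (by omega) hp hb0 hbn, show min (a + 1) b = min a b by omega,
          targetKet_succ]
      -- At `a = p`, `b ≤ a`, the hook ends: source and lowered target are both inadmissible. The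
      -- case `b = n` of raising is analogous.
      · rw [tensorKet, ket_of_not (mt isWeight_half_iff.1 (by omega)), map_zero, targetKet,
          ket_of_not (mt isWeight_target_iff.1 (by omega)), smul_zero]
  · rw [h p a b ha0 hap hb0 hbn, map_smul, JTilde_raise_targetKet (by omega) (by omega)]
    split_ifs with hab
    · rw [h p (a - 1) b (by omega) (by omega) hb0 hbn, show min (a - 1) b = min a b by omega,
        targetKet_pred]
    · by_cases hn : b + 1 ≤ n
      · rw [h p a (b + 1) ha0 hap (by omega) hn, show min a (b + 1) = min a b by omega]
      · rw [tensorKet, h1 _ (mt isWeight_half_iff'.1 (by omega)), LinearMap.zero_apply, targetKet,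
          ket_of_not (mt isWeight_target_iff.1 (by omega)), smul_zero]

/-! ### The selection factor and the crystal Wigner-Eckart formula -/

lemma sel_eq {n p a b α : ℕ} :
    sel ((p : ℚ) / 2) ((p : ℚ) / 2 - a) ((n : ℚ) / 2) (b - (n : ℚ) / 2) α =
      if α = min a b then 1 else 0 := by
  have e1 : ((p : ℚ) / 2 - a = (p : ℚ) / 2 - α) ↔ a = α := by
    rw [sub_right_inj, Nat.cast_inj]
  have e2 : (-((b : ℚ) - (n : ℚ) / 2) = (n : ℚ) / 2 - α) ↔ b = α := by
    rw [neg_sub, sub_right_inj, Nat.cast_inj]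
  have e3 : ((α : ℚ) ≤ (n : ℚ) / 2 + (b - (n : ℚ) / 2)) ↔ α ≤ b := by
    rw [add_sub_cancel, Nat.cast_le]
  have e4 : ((α : ℚ) ≤ (p : ℚ) / 2 - ((p : ℚ) / 2 - a)) ↔ α ≤ a := by
    rw [sub_sub_cancel, Nat.cast_le]
  simp only [sel, δ, θ, e1, e2, e3, e4]
  by_cases ha : a = α <;> by_cases hb : b = α
  · subst ha; simp [hb]
  · subst ha; simp [hb]
  · subst hb
    by_cases hle : b ≤ a
    · simp [ha, hle]
    · simp [ha, hle]
  · have : α ≠ min a b := by omega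
    simp [ha, hb, this]

/-- The reduced matrix elements of a crystal tensor of rank `n / 2`. -/
def crystalReduced (n : ℕ) (τ : ℚ → Op) (J' j₁ : ℚ) : ℂ :=
  (-1 : ℂ) ^ n * (-1 : ℂ) ^ ⌊j₁ + (n : ℚ) / 2 - J'⌋₊ *
    bra J' J' (τ ((n : ℚ) / 2) (ket j₁ (j₁ - ⌊j₁ + (n : ℚ) / 2 - J'⌋₊)))

lemma crystalReduced_eq (n : ℕ) (τ : ℚ → Op) (p α : ℕ) :
    crystalReduced n τ ((p : ℚ) / 2 + (n : ℚ) / 2 - α) ((p : ℚ) / 2) =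
      (-1 : ℂ) ^ n * (-1 : ℂ) ^ α * topAmplitude n τ p α := by
  rw [crystalReduced, sub_sub_cancel, Nat.floor_natCast, topAmplitude, tensorKet,
    Int.cast_natCast, Int.cast_natCast, sub_half, sub_add_eq_add_sub]

lemma HasChainForm.crystalWignerEckart {n : ℕ} {τ : ℚ → Op} (h : HasChainForm n τ) :
    CrystalWignerEckart n τ (crystalReduced n τ) := by
  intro m j₁ m₁ hm hm₁
  obtain ⟨b, hb, rfl⟩ := hm.exists_nat_add
  obtain ⟨p, a, ha, rfl, rfl⟩ := hm₁.exists_half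
  have hab : min a b ∈ Finset.range (n + 1) := Finset.mem_range.2 (by omega)
  rw [Finset.sum_eq_single_of_mem _ hab]
  · have := h p a b (by omega) (by omega) (by omega) (by omega)
    rw [tensorKet, targetKet, ← Nat.cast_min] at this
    simp only [Int.cast_natCast] at this
    rw [this, sel_eq, if_pos rfl, crystalReduced_eq, mul_one, smul_smul]
    congr 1
    have e1 : (-1 : ℂ) ^ n * (-1 : ℂ) ^ n = 1 := by rw [← mul_pow]; simp
    have e2 : (-1 : ℂ) ^ min a b * (-1 : ℂ) ^ min a b = 1 := by rw [← mul_pow]; simp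
    linear_combination -topAmplitude n τ p (min a b : ℕ) *
      ((-1 : ℂ) ^ min a b * (-1 : ℂ) ^ min a b * e1 + e2)
  · intro α _ hα
    rw [sel_eq, if_neg hα, mul_zero, zero_smul]

lemma HasChainForm.equalAmplitudes {n : ℕ} {τ : ℚ → Op} (h : HasChainForm n τ) :
    EqualAmplitudes ((n : ℚ) / 2) τ := by
  have key : ∀ (p a b α : ℕ), a ≤ p → b ≤ n →
      sel ((p : ℚ) / 2) ((p : ℚ) / 2 - a) ((n : ℚ) / 2) (b - (n : ℚ) / 2) α ≠ 0 →
      bra ((p : ℚ) / 2 + (n : ℚ) / 2 - α) ((p : ℚ) / 2 - a + (b - (n : ℚ) / 2))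
        (τ (b - (n : ℚ) / 2) (ket ((p : ℚ) / 2) ((p : ℚ) / 2 - a))) = topAmplitude n τ p α := by
    intro p a b α ha hb hs
    obtain rfl : α = min a b := by
      by_contra hα
      exact hs (by rw [sel_eq, if_neg hα])
    have := h p a b (by omega) (by omega) (by omega) (by omega)
    have hw := (isWeight_target_iff (n := n) (p := p) (α := (min a b : ℕ)) (a := a) (b := b)).2
      (by omega)
    rw [tensorKet, targetKet, ← Nat.cast_min] at this
    simp only [Int.cast_natCast] at this hw
    rw [this, map_smul, bra_ket_self hw, smul_eq_mul, mul_one]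
  intro j₁ m₁ m m₁' m' α hm₁ hm hm₁' hm' hs hs'
  obtain ⟨b, hb, rfl⟩ := hm.exists_nat_add
  obtain ⟨b', hb', rfl⟩ := hm'.exists_nat_add
  obtain ⟨p, a, ha, rfl, rfl⟩ := hm₁.exists_half
  obtain ⟨p', a', ha', hp', rfl⟩ := hm₁'.exists_half
  obtain rfl : p = p' := by
    have : (p : ℚ) = p' := by linarith
    exact_mod_cast this
  rw [key p a b α ha hb hs, key p a' b' α ha' hb' hs']

/-! ### The limit of a `q`-tensor -/

lemma neg_one_pow_mul_hwCoeff_pos {q : ℝ} (hq : 0 < q) (hq1 : q < 1) {j₁ j J' : ℚ}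
    (h : IsTriangle j₁ j J') {k : ℕ} (hk : (k : ℚ) ≤ j₁ + j - J') :
    0 < (-1 : ℝ) ^ k * hwCoeff q j₁ j J' k := by
  have hb := h.bounds
  induction k with
  | zero => simp [hwCoeff]
  | succ k ih =>
    push_cast at hk
    have hk0 : (0 : ℚ) ≤ k := by positivity
    have h1 : 0 < F q 1 j (J' - j₁ + k) := F_pos hq hq1 (by linarith) (by linarith)
    have h2 : 0 < F q 1 j₁ (j₁ - k - 1) := F_pos hq hq1 (by linarith) (by linarith)
    have h3 : 0 < q ^ ((-J' - 1 : ℚ) : ℝ) := Real.rpow_pos_of_pos hq _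
    have : (-1 : ℝ) ^ (k + 1) * hwCoeff q j₁ j J' (k + 1) =
        (-1 : ℝ) ^ k * hwCoeff q j₁ j J' k * (q ^ ((-J' - 1 : ℚ) : ℝ) *
          F q 1 j (J' - j₁ + k) / F q 1 j₁ (j₁ - k - 1)) := by
      rw [hwCoeff]; ring
    rw [this]
    have := ih (by linarith)
    positivity

lemma hwCoeff_ne_zero {q : ℝ} (hq : 0 < q) (hq1 : q < 1) {j₁ j J' : ℚ}
    (h : IsTriangle j₁ j J') {k : ℕ} (hk : (k : ℚ) ≤ j₁ + j - J') : hwCoeff q j₁ j J' k ≠ 0 :=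
  right_ne_zero_of_mul (neg_one_pow_mul_hwCoeff_pos hq hq1 h hk).ne'

/-- The ratio is of order `q^(J' + 1 + j - j₁)`, a positive exponent by the triangle condition. -/
lemma tendsto_hwCoeff_div_succ {j₁ j J' : ℚ} (h : IsTriangle j₁ j J') {k : ℕ}
    (hk : (k : ℚ) + 1 ≤ j₁ + j - J') :
    Tendsto (fun q => hwCoeff q j₁ j J' k / hwCoeff q j₁ j J' (k + 1)) (𝓝[>] (0 : ℝ)) (𝓝 0) := by
  have hb := h.bounds
  have hk0 : (0 : ℚ) ≤ k := by positivity
  have he : (0 : ℝ) < ((J' + 1 + j - j₁ : ℚ) : ℝ) := by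
    exact_mod_cast (by linarith : (0 : ℚ) < J' + 1 + j - j₁)
  have h1 := tendsto_F_of_pos (s := 1) (j := j) (m := J' - j₁ + k) (by linarith) (by linarith)
  have h2 := tendsto_F_of_pos (s := 1) (j := j₁) (m := j₁ - k - 1) (by linarith) (by linarith)
  have h3 := ((h2.div h1 one_ne_zero).mul (tendsto_rpow_of_pos he)).neg
  rw [mul_zero, neg_zero] at h3
  refine h3.congr' ?_
  filter_upwards [eventually_mem_Ioo] with q ⟨hq, hq1⟩
  have n1 : F q 1 j (J' - j₁ + k) ≠ 0 := (F_pos hq hq1 (by linarith) (by linarith)).ne'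
  have n2 : F q 1 j₁ (j₁ - k - 1) ≠ 0 := (F_pos hq hq1 (by linarith) (by linarith)).ne'
  have n3 : hwCoeff q j₁ j J' k ≠ 0 := hwCoeff_ne_zero hq hq1 h (by linarith)
  have e : q ^ ((J' + 1 + j - j₁ : ℚ) : ℝ) =
      q ^ ((j : ℝ) - 1 / 2) / (q ^ ((j₁ : ℝ) - 1 / 2) * q ^ ((-J' - 1 : ℚ) : ℝ)) := by
    rw [← Real.rpow_add hq, ← Real.rpow_sub hq]
    congr 1
    push_cast
    ring
  have p1 := (Real.rpow_pos_of_pos hq ((j : ℝ) - 1 / 2)).ne'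
  have p2 := (Real.rpow_pos_of_pos hq ((j₁ : ℝ) - 1 / 2)).ne'
  have p3 := (Real.rpow_pos_of_pos hq ((-J' - 1 : ℚ) : ℝ)).ne'
  rw [Pi.div_apply, hwCoeff, e]
  field_simp

lemma tendsto_hwCoeff_div {j₁ j J' : ℚ} (h : IsTriangle j₁ j J') (d : ℕ) {k : ℕ}
    (hk : ((k + d + 1 : ℕ) : ℚ) ≤ j₁ + j - J') :
    Tendsto (fun q => hwCoeff q j₁ j J' k / hwCoeff q j₁ j J' (k + d + 1)) (𝓝[>] (0 : ℝ))
      (𝓝 0) := by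
  induction d generalizing k with
  | zero => exact tendsto_hwCoeff_div_succ h (by push_cast at hk; linarith)
  | succ d ih =>
    push_cast at hk
    have hd : (0 : ℚ) ≤ d := by positivity
    have h1 := ih (k := k + 1) (by push_cast; linarith)
    have h2 := tendsto_hwCoeff_div_succ h (k := k) (by linarith)
    have h3 := h2.mul h1
    rw [mul_zero] at h3
    refine h3.congr' ?_
    filter_upwards [eventually_mem_Ioo] with q ⟨hq, hq1⟩
    rw [div_mul_div_cancel₀ (hwCoeff_ne_zero hq hq1 h (by push_cast; linarith)),
      show k + 1 + d + 1 = k + (d + 1) + 1 by ring]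

/-- In the limit only the last coefficient of the highest weight vector survives. -/
lemma tendsto_hwNorm_div {j₁ j J' : ℚ} (h : IsTriangle j₁ j J') {α : ℕ}
    (hα : j₁ + j - J' = α) :
    Tendsto (fun q => hwNorm q j₁ j J' / hwCoeff q j₁ j J' α) (𝓝[>] (0 : ℝ))
      (𝓝 ((-1) ^ α)) := by
  have h1 : Tendsto (fun q => ∑ k ∈ Finset.range α,
      (hwCoeff q j₁ j J' k / hwCoeff q j₁ j J' α) ^ 2) (𝓝[>] (0 : ℝ))
      (𝓝 (∑ _k ∈ Finset.range α, 0)) := by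
    refine tendsto_finsetSum _ fun k hk => ?_
    rw [Finset.mem_range] at hk
    have := (tendsto_hwCoeff_div h (α - k - 1) (k := k)
      (by rw [hα, show k + (α - k - 1) + 1 = α by omega])).pow 2
    rwa [show k + (α - k - 1) + 1 = α by omega, zero_pow two_ne_zero] at this
  have h2 := ((h1.add_const 1).sqrt).const_mul ((-1 : ℝ) ^ α)
  rw [Finset.sum_const_zero, zero_add, Real.sqrt_one, mul_one] at h2
  refine h2.congr' ?_
  filter_upwards [eventually_mem_Ioo] with q ⟨hq, hq1⟩
  have hpos := neg_one_pow_mul_hwCoeff_pos hq hq1 h (k := α) hα.ge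
  have hne := hwCoeff_ne_zero hq hq1 h (k := α) hα.ge
  have hs : (-1 : ℝ) ^ α * (-1 : ℝ) ^ α = 1 := by rw [← mul_pow]; simp
  rw [eq_div_iff hne, hwNorm, hα, Nat.floor_natCast, Finset.sum_range_succ]
  set c := hwCoeff q j₁ j J' α
  -- The factor is written as the square of `(-1)^α c`, which is positive, so that the root extracts
  -- it without an absolute value.
  have e : ∑ k ∈ Finset.range α, hwCoeff q j₁ j J' k ^ 2 + c ^ 2 =
      ((-1) ^ α * c) ^ 2 * (∑ k ∈ Finset.range α, (hwCoeff q j₁ j J' k / c) ^ 2 + 1) := by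
    have e1 : ((-1) ^ α * c) ^ 2 = c ^ 2 := by rw [mul_pow, sq ((-1 : ℝ) ^ α), hs, one_mul]
    rw [e1, mul_add, Finset.mul_sum, mul_one]
    congr 1
    refine Finset.sum_congr rfl fun k _ => ?_
    field_simp
  rw [e, Real.sqrt_mul (sq_nonneg _), Real.sqrt_sq hpos.le]
  ring

/-! ### Passing to the limit in matrix elements -/

section Limit

variable {n : ℕ} {T : ℝ → ℚ → Op} {τ : ℚ → Op}

lemma limit_eq_zero_of_not_weight {j : ℚ} (hT : ∀ᶠ q in 𝓝[>] (0 : ℝ), IsQTensor q j (T q))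
    (hτ : ∀ m, OpTendsto (fun q => T q m) (τ m)) {m : ℚ} (hm : ¬ IsWeight j m) : τ m = 0 := by
  refine linearMap_ext_ket fun j₁ m₁ _ => ext_bra fun J' M _ => ?_
  refine tendsto_nhds_unique (hτ m J' M j₁ m₁) (tendsto_const_nhds.congr' ?_)
  filter_upwards [hT] with q hTq
  rw [hTq.eq_zero m hm]

lemma limit_bra_ket_eq_zero {j : ℚ} (hT : ∀ᶠ q in 𝓝[>] (0 : ℝ), IsQTensor q j (T q))
    (hτ : ∀ m, OpTendsto (fun q => T q m) (τ m)) {J' M m j₁ m₁ : ℚ} (hM : M ≠ m₁ + m) :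
    bra J' M (τ m (ket j₁ m₁)) = 0 := by
  refine tendsto_nhds_unique (hτ m J' M j₁ m₁) (tendsto_const_nhds.congr' ?_)
  filter_upwards [hT] with q hTq
  rw [hTq.bra_ket_eq_zero hM]

lemma limit_adJ3 {j : ℚ} (hT : ∀ᶠ q in 𝓝[>] (0 : ℝ), IsQTensor q j (T q))
    (hτ : ∀ m, OpTendsto (fun q => T q m) (τ m)) (m : ℚ) : adJ3 (τ m) = (m : ℂ) • τ m := by
  refine linearMap_ext_ket fun j₁ m₁ _ => ext_bra fun J' M _ => ?_
  simp only [adJ3, LinearMap.sub_apply, Module.End.mul_apply, J3_ket, bra_J3, map_smul, map_sub,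
    smul_eq_mul, LinearMap.smul_apply]
  by_cases hM : M = m₁ + m
  · rw [hM]; push_cast; ring
  · rw [limit_bra_ket_eq_zero hT hτ hM]; simp

lemma limit_eq_zero_of_not_triangle {j : ℚ}
    (hT : ∀ᶠ q in 𝓝[>] (0 : ℝ), IsQTensor q j (T q))
    (hτ : ∀ m, OpTendsto (fun q => T q m) (τ m)) {J' M j₁ : ℚ} (hJ : IsWeight J' M)
    (h : ¬ IsTriangle j₁ j J') (m₁ m : ℚ) : bra J' M (τ m (ket j₁ m₁)) = 0 := by
  refine tendsto_nhds_unique (hτ m J' M j₁ m₁) (tendsto_const_nhds.congr' ?_)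
  filter_upwards [hT, eventually_mem_Ioo] with q hTq ⟨hq, hq1⟩
  rw [hTq.eq_zero_of_not_triangle hq hq1 hJ h]

lemma hasChainForm_of_limit (hT : ∀ᶠ q in 𝓝[>] (0 : ℝ), IsQTensor q ((n : ℚ) / 2) (T q))
    (hτ : ∀ m, OpTendsto (fun q => T q m) (τ m)) : HasChainForm n τ := by
  intro p a b ha0 hap hb0 hbn
  refine ext_bra fun J' M hJ => ?_
  rw [map_smul, targetKet, tensorKet]
  by_cases hM : M = (p : ℚ) / 2 - a + (b - (n : ℚ) / 2)
  swap
  · rw [bra_ket_of_ne fun h' => hM h'.2, smul_zero, limit_bra_ket_eq_zero hT hτ hM]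
  subst hM
  obtain ⟨α, hα⟩ : ∃ α : ℤ, J' = (p : ℚ) / 2 + (n : ℚ) / 2 - α := by
    obtain ⟨k, hk⟩ := hJ.1
    exact ⟨n + a - b - k, by push_cast; linarith⟩
  subst hα
  by_cases h : IsTriangle ((p : ℚ) / 2) ((n : ℚ) / 2) ((p : ℚ) / 2 + (n : ℚ) / 2 - α)
  · obtain ⟨⟨x, hx⟩, ⟨y, hy⟩, z, hz⟩ := h
    have hα0 : α = x := by exact_mod_cast (by linarith : (α : ℚ) = x)
    have hαp : p - α = y := by exact_mod_cast (by linarith : (p : ℚ) - α = y)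
    have hαn : n - α = z := by exact_mod_cast (by linarith : (n : ℚ) - α = z)
    have hrel := limitRelations hT hτ p (α := α) (by omega)
    by_cases hab : min a b = α
    · have := hrel.eq_top (by omega) (by omega) (by omega) hap hbn hab
      rw [hab, bra_ket_self hJ, smul_eq_mul, mul_one, topAmplitude, tensorKet]
      exact this
    · have := hrel.eq_zero (by omega) (by omega) ha0 hap hb0 hbn hab
      rw [bra_ket_of_ne, smul_zero]
      · exact this
      · rintro ⟨h', -⟩
        exact hab (by exact_mod_cast (by linarith : ((min a b : ℤ) : ℚ) = α))
  -- Off the triangle the target vector has no component either, because the spin `j₁ + j - min a b`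
  -- always satisfies the triangle condition.
  · rw [limit_eq_zero_of_not_triangle hT hτ hJ h, bra_ket_of_ne, smul_zero]
    rintro ⟨h', -⟩
    rw [h'] at h
    have e : ∀ z : ℤ, 0 ≤ z → ((z.toNat : ℕ) : ℚ) = z := by
      intro z hz
      lift z to ℕ using hz
      simp
    refine h ⟨⟨(min a b).toNat, ?_⟩, ⟨(p - min a b).toNat, ?_⟩, (n - min a b).toNat, ?_⟩
    · rw [e _ (by omega)]; ring
    · rw [e _ (by omega), Int.cast_sub, Int.cast_natCast]; ring
    · rw [e _ (by omega), Int.cast_sub, Int.cast_natCast]; ring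

/-- `reducedElement` is taken at the start of the highest weight chain, where for `α > 0` the norm
diverges and the matrix element tends to zero. Moving to the end of the chain, `m = j`, replaces the
norm by `hwNorm / hwCoeff α`, which tends to `(-1)^α`. -/
lemma tendsto_reducedElement (hT : ∀ᶠ q in 𝓝[>] (0 : ℝ), IsQTensor q ((n : ℚ) / 2) (T q))
    (hτ : ∀ m, OpTendsto (fun q => T q m) (τ m)) {J' j₁ : ℚ}
    (h : IsTriangle j₁ ((n : ℚ) / 2) J') :
    Tendsto (fun q => (-1 : ℂ) ^ n * reducedElement q ((n : ℚ) / 2) (T q) J' j₁) (𝓝[>] (0 : ℝ))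
      (𝓝 (crystalReduced n τ J' j₁)) := by
  obtain ⟨α, hα⟩ := h.1
  have h1 := (Complex.continuous_ofReal.tendsto _).comp (tendsto_hwNorm_div h hα)
  have h2 := (h1.mul (hτ ((n : ℚ) / 2) J' J' j₁ (j₁ - α))).const_mul ((-1 : ℂ) ^ n)
  rw [crystalReduced, hα, Nat.floor_natCast, mul_assoc]
  push_cast at h2
  refine h2.congr' ?_
  filter_upwards [hT, eventually_mem_Ioo] with q hTq ⟨hq, hq1⟩
  have h3 := hTq.highest_eq hq hq1 h (i := α) (by rw [hα, Nat.floor_natCast])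
  rw [show J' - j₁ + α = (n : ℚ) / 2 by linarith] at h3
  have hne : ((hwCoeff q j₁ ((n : ℚ) / 2) J' α : ℝ) : ℂ) ≠ 0 := by
    exact_mod_cast hwCoeff_ne_zero hq hq1 h hα.ge
  rw [h3, reducedElement, Function.comp_apply, Complex.ofReal_div]
  field_simp

/-- `([j][j+1])^(1/2)` is `F^+(j, 0)`, of the same order in `q` as `F^±(j, m)`, and the ratio tends
to `1`. -/
lemma tendsto_adJTilde {j : ℚ} (hT : ∀ᶠ q in 𝓝[>] (0 : ℝ), IsQTensor q j (T q))
    (hτ : ∀ m, OpTendsto (fun q => T q m) (τ m)) {s : ℚ} (hs : s = 1 ∨ s = -1) {m : ℚ}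
    (hm : IsWeight j m) : OpTendsto (fun q => adJTilde q j s (T q m)) (τ (m + s)) := by
  intro J' M j₁ m₁
  by_cases hms : IsWeight j (m + s)
  swap
  -- This branch includes `j = 0`, where `m + s` is never a weight.
  · rw [limit_eq_zero_of_not_weight hT hτ hms]
    refine tendsto_const_nhds.congr' ?_
    filter_upwards [hT] with q hTq
    rw [adJTilde, hTq.shift s hs m hm, hTq.eq_zero _ hms, smul_zero, smul_zero]
  have hlt : 0 < j - s * m ∧ 0 < j + s * m + 1 ∧ 0 < j := by
    have h1 := hm.le
    have h2 := hm.neg_le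
    have h3 := hms.le
    have h4 := hms.neg_le
    rcases hs with rfl | rfl <;> refine ⟨?_, ?_, ?_⟩ <;> linarith
  have h1 := tendsto_F_of_pos hlt.1 hlt.2.1
  have h2 := tendsto_F_of_pos (s := 1) (j := j) (m := 0) (by linarith) (by linarith)
  have h3 := ((Complex.continuous_ofReal.tendsto _).comp (h1.div h2 one_ne_zero)).mul
    (hτ (m + s) J' M j₁ m₁)
  rw [div_one, Complex.ofReal_one, one_mul] at h3
  refine h3.congr' ?_
  filter_upwards [hT, eventually_mem_Ioo] with q hTq ⟨hq, hq1⟩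
  have hj : (0 : ℝ) < j := by exact_mod_cast hlt.2.2
  have e : (qNum q (j : ℝ) * qNum q ((j + 1 : ℚ) : ℝ)) ^ (-(1 / 2) : ℝ) = (F q 1 j 0)⁻¹ := by
    rw [Real.rpow_neg (mul_nonneg (qNum_nonneg hq hq1 hj.le)
      (qNum_nonneg hq hq1 (by push_cast; linarith))), ← Real.sqrt_eq_rpow, F]
    simp
  have hp := (Real.rpow_pos_of_pos hq ((j : ℝ) - 1 / 2)).ne'
  rw [adJTilde, hTq.shift s hs m hm, e, smul_smul, LinearMap.smul_apply, map_smul, smul_eq_mul,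
    Function.comp_apply, Pi.div_apply, mul_div_mul_right _ _ hp, div_eq_inv_mul,
    Complex.ofReal_mul]

end Limit

end CrystalTensor

end

theorem mainTheorem2 (n : ℕ) (j : ℚ) (hj : j = n / 2) :
    -- crystal tensors of rank `j` obey the crystal Wigner-Eckart theorem
    (∀ τ : ℚ → Op, IsCrystalTensor j τ →
      (∃ r : ℚ → ℚ → ℂ, CrystalWignerEckart n τ r) ∧ EqualAmplitudes j τ) ∧
    -- the limits of regularised `q`-tensors `Γ T Γ` are crystal tensors
    (∀ (T : ℝ → ℚ → Op) (Γ : ℝ → Op) (τ : ℚ → Op),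
      (∀ᶠ q in 𝓝[>] (0 : ℝ), IsQTensor q j (T q)) →
      (∀ᶠ q in 𝓝[>] (0 : ℝ), IsCentral q (Γ q)) →
      (∀ m, OpTendsto (fun q => Γ q * T q m * Γ q) (τ m)) →
      IsCrystalTensor j τ ∧
      -- `J̃_±(τ_m) = τ_{m ± 1}`, where `J̃_± = C^{-1/2} J_±` and `C` acts as `[j][j+1]`
      (∀ᶠ q in 𝓝[>] (0 : ℝ), ∀ m, adCasimir q (Γ q * T q m * Γ q) =
        ((qNum q (j : ℝ) * qNum q ((j + 1 : ℚ) : ℝ) : ℝ) : ℂ) • (Γ q * T q m * Γ q)) ∧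
      (∀ s : ℚ, s = 1 ∨ s = -1 → ∀ m, IsWeight j m →
        OpTendsto (fun q => adJTilde q j s (Γ q * T q m * Γ q)) (τ (m + s))) ∧
      -- the reduced matrix elements of `τ` are the limits of those of `Γ T Γ`
      ∃ (R : ℝ → ℚ → ℚ → ℂ) (r : ℚ → ℚ → ℂ),
        (∀ᶠ q in 𝓝[>] (0 : ℝ), QWignerEckart q n (fun m => Γ q * T q m * Γ q) (R q)) ∧
        (∀ j₁ J, IsTriangle j₁ j J →
          Tendsto (fun q => R q J j₁ / ((Real.sqrt (qNum q ((2 * J + 1 : ℚ) : ℝ)) : ℝ) : ℂ))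
            (𝓝[>] (0 : ℝ)) (𝓝 (r J j₁))) ∧
        CrystalWignerEckart n τ r) := by
  subst hj
  refine ⟨fun τ hτ => ⟨⟨_, hτ.hasChainForm.crystalWignerEckart⟩, hτ.hasChainForm.equalAmplitudes⟩,
    fun T Γ τ hT hΓ hτ => ?_⟩
  have hT' : ∀ᶠ q in 𝓝[>] (0 : ℝ),
      IsQTensor q ((n : ℚ) / 2) ((fun q m => Γ q * T q m * Γ q) q) := by
    filter_upwards [hT, hΓ] with q h1 h2 using h1.central_mul_mul h2
  have hchain := hasChainForm_of_limit hT' hτ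
  refine ⟨hchain.isCrystalTensor (fun m hm => limit_eq_zero_of_not_weight hT' hτ hm)
      (fun m _ => limit_adJ3 hT' hτ m), ?_,
    fun s hs m hm => tendsto_adJTilde hT' hτ hs hm,
    fun q J' j₁ => (-1 : ℂ) ^ n * ((Real.sqrt (qNum q ((2 * J' + 1 : ℚ) : ℝ)) : ℝ) : ℂ) *
        reducedElement q ((n : ℚ) / 2) (fun m => Γ q * T q m * Γ q) J' j₁,
    crystalReduced n τ, ?_, fun j₁ J' h => ?_, hchain.crystalWignerEckart⟩
  · filter_upwards [hT', eventually_mem_Ioo] with q h ⟨hq, hq1⟩ m using h.adCasimir_eq hq hq1 m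
  · filter_upwards [hT', eventually_mem_Ioo] with q h ⟨hq, hq1⟩ using h.wignerEckart hq hq1
  · refine (tendsto_reducedElement hT' hτ h).congr' ?_
    filter_upwards [eventually_mem_Ioo] with q ⟨hq, hq1⟩
    have hJ : 0 ≤ J' := by have := h.bounds; linarith
    have hne : ((Real.sqrt (qNum q ((2 * J' + 1 : ℚ) : ℝ)) : ℝ) : ℂ) ≠ 0 := by
      exact_mod_cast (Real.sqrt_pos.2 (qNum_pos hq hq1
        (by exact_mod_cast (by linarith : (0 : ℚ) < 2 * J' + 1)))).ne'
    field_simp
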